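/- Let $d\ge 1$, let $\mathcal A,\Theta\subset\mathbb R^d$ be finite sets contained in the closed Euclidean unit ball, and consider the following $d$-dimensional linear bandit. The true parameter $\theta^*$ is a random variable with values in $\Theta$ (its law is the prior). In period $t=1,2,\dots$ an agent plays an action $A_t\in\mathcal A$ and observes the reward $R_t=g(A_t,\theta^*,W_t)$, where $g$ is a fixed function with values in $[-\tfrac12,\tfrac12]$ on $\mathcal A\times\Theta\times\mathcal W$ ($\mathcal W$ being the space in which the noise takes its values) and the noise variables $W_1,W_2,\dots$ are i.i.d.; the mean reward is linear, $$\mu(a,\theta):=\mathbb E[g(a,\theta,W_1)]=\tfrac12 a^\top\theta\qquad\text{for all } a\in\mathcal A,\ \theta\in\Theta .$$ For each $\theta\in\Theta$ let $\alpha(\theta)\in\operatorname{argmax}_{a\in\mathcal A}\mu(a,\theta)$ be a fixed choice of optimal action, and put $A^*=\alpha(\theta^*)$ and $R^*=\mu(A^*,\theta^*)$. The actions are given by a policy $A_t=\pi_t(\mathcal H_{t-1},\xi_t)$, where $\mathcal H_{t-1}=(A_1,R_1,\dots,A_{t-1},R_{t-1})$ is the history and $\xi_t$ is the algorithmic randomness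 of period $t$; the variables $\theta^*,W_1,W_2,\dots,\xi_1,\xi_2,\dots$ are mutually independent. The policy is Thompson sampling, $\pi=\pi^{\mathrm{TS}}$, if for all $t\ge 1$ and $a\in\mathcal A$, almost surely, $$\mathbb P(A_t=a\mid\mathcal H_{t-1})=\mathbb P(A^*=a\mid\mathcal H_{t-1}).$$ Then, for every $T\in\mathbb N$, the Bayesian regret of Thompson sampling satisfies $$\mathrm{BayesRegret}(T;\pi^{\mathrm{TS}}):=\mathbb E\Big[\sum_{t=1}^T\big(R^*-R_t\big)\Big]\le d\sqrt{T\log\Big(3+\frac{3\sqrt{2T}}{d}\Big)} .$$ In particular, the bound does not depend on the number of actions. -/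

import Mathlib

open MeasureTheory ProbabilityTheory

noncomputable section

namespace BayesBandit

/-- A bandit problem with vector-valued actions and parameters whose observed outcome is the
reward itself: finite action set, finite parameter set, a system function `g` and the law of the
exogenous noise. Playing `a` under the model `θ` with noise `w` yields the reward `g a θ w`. -/
structure Bandit (d : ℕ) (𝒲 : Type*) [MeasurableSpace 𝒲] where
  actions : Finset (EuclideanSpace ℝ (Fin d))
  params : Finset (EuclideanSpace ℝ (Fin d))
  g : EuclideanSpace ℝ (Fin d) → EuclideanSpace ℝ (Fin d) → 𝒲 → ℝ
  noiseLaw : Measure 𝒲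
  isProbabilityMeasure_noiseLaw : IsProbabilityMeasure noiseLaw
  measurable_g : ∀ a ∈ actions, ∀ θ ∈ params, Measurable (g a θ)

variable {d : ℕ} {𝒲 Ξ Ω : Type*} [MeasurableSpace 𝒲] [MeasurableSpace Ξ] [MeasurableSpace Ω]

/-- The mean reward `μ(a, θ)` of the action `a` under the model `θ`. -/
def Bandit.meanReward (B : Bandit d 𝒲) (a θ : EuclideanSpace ℝ (Fin d)) : ℝ :=
  ∫ w, B.g a θ w ∂B.noiseLaw

/-- The linear bandit setting: rewards lie in `[-1/2, 1/2]` and `μ(a, θ) = aᵀθ / 2`. -/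
structure Bandit.IsLinear (B : Bandit d 𝒲) : Prop where
  reward_mem : ∀ a ∈ B.actions, ∀ θ ∈ B.params, ∀ w, B.g a θ w ∈ Set.Icc (-(1 / 2) : ℝ) (1 / 2)
  meanReward_eq : ∀ a ∈ B.actions, ∀ θ ∈ B.params, B.meanReward a θ = 1 / 2 * inner ℝ a θ

/-- `α` selects an optimal action for every parameter (ties are broken arbitrarily). -/
def Bandit.IsOptimalAction (B : Bandit d 𝒲)
    (α : EuclideanSpace ℝ (Fin d) → EuclideanSpace ℝ (Fin d)) : Prop :=
  ∀ θ ∈ B.params, α θ ∈ B.actions ∧ ∀ a ∈ B.actions, B.meanReward a θ ≤ B.meanReward (α θ) θ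

/-- A (randomized) policy: for each period, a map from the history of the preceding periods
(the actions played and the rewards observed) and the algorithmic noise of that period to an
action. Periods are numbered from `0`, so period `t` has `t` predecessors. -/
structure Policy (B : Bandit d 𝒲) (Ξ : Type*) [MeasurableSpace Ξ] where
  act : (t : ℕ) → (Fin t → EuclideanSpace ℝ (Fin d) × ℝ) → Ξ → EuclideanSpace ℝ (Fin d)
  act_mem : ∀ t h x, act t h x ∈ B.actions
  measurable_act : ∀ t, Measurable (Function.uncurry (act t))

/-- The randomness on which the interaction is built: the true parameter `θ` (its law under `P`
is the prior), the outcome noise `W t` and the algorithmic noise `ξ t` of the periods `t`. The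
`W t` have the noise law of the bandit, and all these variables are mutually independent. -/
structure IsModel (B : Bandit d 𝒲) (P : Measure Ω) (θ : Ω → EuclideanSpace ℝ (Fin d))
    (W : ℕ → Ω → 𝒲) (ξ : ℕ → Ω → Ξ) : Prop where
  measurable_param : Measurable θ
  param_mem : ∀ ω, θ ω ∈ B.params
  measurable_noise : ∀ t, Measurable (W t)
  map_noise : ∀ t, P.map (W t) = B.noiseLaw
  measurable_algNoise : ∀ t, Measurable (ξ t)
  iIndepFun_noise : iIndepFun W P
  iIndepFun_algNoise : iIndepFun ξ P
  indepFun_param_noise : IndepFun θ (fun ω t => W t ω) P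
  indepFun_algNoise : IndepFun (fun ω => (θ ω, fun t => W t ω)) (fun ω t => ξ t ω) P

/-- The history of the first `t` periods when the policy `π` interacts with the bandit. -/
def history (B : Bandit d 𝒲) (π : Policy B Ξ) (θ : Ω → EuclideanSpace ℝ (Fin d))
    (W : ℕ → Ω → 𝒲) (ξ : ℕ → Ω → Ξ) : (t : ℕ) → Ω → Fin t → EuclideanSpace ℝ (Fin d) × ℝ
  | 0, _ => Fin.elim0
  | t + 1, ω =>
    Fin.snoc (α := fun _ => EuclideanSpace ℝ (Fin d) × ℝ) (history B π θ W ξ t ω)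
      (π.act t (history B π θ W ξ t ω) (ξ t ω),
        B.g (π.act t (history B π θ W ξ t ω) (ξ t ω)) (θ ω) (W t ω))

/-- The action played in period `t`. -/
def action (B : Bandit d 𝒲) (π : Policy B Ξ) (θ : Ω → EuclideanSpace ℝ (Fin d))
    (W : ℕ → Ω → 𝒲) (ξ : ℕ → Ω → Ξ) (t : ℕ) (ω : Ω) : EuclideanSpace ℝ (Fin d) :=
  π.act t (history B π θ W ξ t ω) (ξ t ω)

/-- The reward received in period `t`. -/
def reward (B : Bandit d 𝒲) (π : Policy B Ξ) (θ : Ω → EuclideanSpace ℝ (Fin d))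
    (W : ℕ → Ω → 𝒲) (ξ : ℕ → Ω → Ξ) (t : ℕ) (ω : Ω) : ℝ :=
  B.g (action B π θ W ξ t ω) (θ ω) (W t ω)

/-- Thompson sampling: in every period, the conditional law of the action played given the history
is the posterior law of the optimal action `α θ`. -/
def IsThompsonSampling (B : Bandit d 𝒲)
    (α : EuclideanSpace ℝ (Fin d) → EuclideanSpace ℝ (Fin d)) (π : Policy B Ξ) (P : Measure Ω)
    (θ : Ω → EuclideanSpace ℝ (Fin d)) (W : ℕ → Ω → 𝒲) (ξ : ℕ → Ω → Ξ) : Prop :=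
  ∀ (t : ℕ), ∀ a ∈ B.actions,
    P⟦{ω | action B π θ W ξ t ω = a} |
        MeasurableSpace.comap (history B π θ W ξ t) inferInstance⟧
      =ᵐ[P]
    P⟦{ω | α (θ ω) = a} | MeasurableSpace.comap (history B π θ W ξ t) inferInstance⟧

/-- The Bayesian regret over the first `T` periods. -/
def bayesRegret (B : Bandit d 𝒲)
    (α : EuclideanSpace ℝ (Fin d) → EuclideanSpace ℝ (Fin d)) (π : Policy B Ξ) (P : Measure Ω)
    (θ : Ω → EuclideanSpace ℝ (Fin d)) (W : ℕ → Ω → 𝒲) (ξ : ℕ → Ω → Ξ) (T : ℕ) : ℝ :=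
  ∫ ω, ∑ t ∈ Finset.range T, (B.meanReward (α (θ ω)) (θ ω) - reward B π θ W ξ t ω) ∂P

end BayesBandit

end

/-! The square of the regret of one round, up to a discretization error, is at most a multiple of
`d` times the information which that round yields about the parameter at a finite resolution. The
total information is at most the logarithm of the number of cells, which depends on the dimension
and the resolution but not on the number of actions.

Cut the parameters into cells of radius `r` around a net of at most `(1 + 2 / r) ^ d` points, and
let `p` be the posterior before some round. Given the history, Thompson sampling plays an
independent copy of the optimal action, so the expected regret of the round is half of `∑ p x ⟨α x,
x - wmean⟩`. Replacing `x` by the mean of its cell costs at most `r / 2`. What remains is `∑ p x ⟨α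
x, v x⟩` with `v x = cellMean - wmean`, a kind of trace, and `sq_sum_inner_le` bounds its square by
`d ∑∑ p x p y ⟨α y, v x⟩²`, that is by `4 d` times `infoGain` (see `stepRegret_le`).

The information gains are summed without entropies. Every cell `k` carries an exponential weight
that bets on the prediction of the mean reward given `k` against the unconditional prediction. By
Hoeffding's lemma these weights have expectation at most `1` (`integral_exp_logWeight_le_one`),
while the logarithm of the weight of the true cell grows on average by twice the information gain
(`integral_logWeightInc`). The weight of the true cell is at most the sum of all weights, so a
Jensen-type inequality gives `2 ∑ infoGain ≤ log |C|` (`sum_integral_infoGain_le`).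

An arithmetic-geometric inequality with parameter `η` combines the two bounds;
`regret_bound_optimize` tunes `η` for the chosen `r`. The bandit model enters only through the
interface `PosteriorSampling`. -/

noncomputable section

namespace BayesBandit

/-! ### Covering the unit ball -/

open Module Metric in
/-- Volume bound for the cardinality of an `r`-separated subset of the unit ball. -/
theorem card_le_of_separated_unitBall {E : Type*} [NormedAddCommGroup E] [NormedSpace ℝ E]
    [FiniteDimensional ℝ E] {r : ℝ} (hr : 0 < r) (s : Finset E) (hs : ∀ c ∈ s, ‖c‖ ≤ 1)
    (h : ∀ c ∈ s, ∀ d ∈ s, c ≠ d → r ≤ ‖c - d‖) :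
    (s.card : ℝ) ≤ (1 + 2 / r) ^ finrank ℝ E := by
  borelize E
  let μ : Measure E := Measure.addHaar
  have hδ : 0 < r / 2 := by positivity
  have hρ : 0 < 1 + r / 2 := by positivity
  -- Packing: the balls of radius `r / 2` are disjoint and fit into the ball of radius `1 + r / 2`,
  -- so volumes bound their number.
  have hdisj : Set.PairwiseDisjoint (s : Set E) fun c => ball c (r / 2) := by
    intro c hc d hd hcd
    apply ball_disjoint_ball
    rw [dist_eq_norm]
    linarith [h c hc d hd hcd]
  have hsub : (⋃ c ∈ s, ball c (r / 2)) ⊆ ball (0 : E) (1 + r / 2) := by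
    refine Set.iUnion₂_subset fun x hx => ball_subset_ball' ?_
    rw [dist_zero_right]
    linarith [hs x hx]
  have hvol : (s.card : ENNReal) * ENNReal.ofReal ((r / 2) ^ finrank ℝ E) * μ (ball 0 1) ≤
      ENNReal.ofReal ((1 + r / 2) ^ finrank ℝ E) * μ (ball 0 1) :=
    calc
      (s.card : ENNReal) * ENNReal.ofReal ((r / 2) ^ finrank ℝ E) * μ (ball 0 1)
          = μ (⋃ c ∈ s, ball c (r / 2)) := by
        rw [measure_biUnion_finset hdisj fun c _ => measurableSet_ball]
        simp only [μ.addHaar_ball_of_pos _ hδ, Finset.sum_const, nsmul_eq_mul, mul_assoc]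
      _ ≤ μ (ball (0 : E) (1 + r / 2)) := measure_mono hsub
      _ = _ := by simp only [μ.addHaar_ball_of_pos _ hρ]
  have hvol' := (ENNReal.mul_le_mul_iff_left (measure_ball_pos μ _ zero_lt_one).ne'
    measure_ball_lt_top.ne).1 hvol
  have key : (s.card : ℝ) * (r / 2) ^ finrank ℝ E ≤ (1 + r / 2) ^ finrank ℝ E := by
    have := ENNReal.toReal_le_of_le_ofReal (pow_nonneg hρ.le _) hvol'
    rwa [ENNReal.toReal_mul, ENNReal.toReal_natCast, ENNReal.toReal_ofReal (by positivity)] at this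
  have h2 : (1 : ℝ) + 2 / r = (1 + r / 2) / (r / 2) := by field_simp; ring
  rw [h2, div_pow, le_div_iff₀ (by positivity)]
  exact key

/-- A finite subset of the unit ball has an `r`-net of cardinality at most `(1 + 2 / r) ^ dim`. -/
theorem exists_net {E : Type*} [NormedAddCommGroup E] [NormedSpace ℝ E]
    [FiniteDimensional ℝ E] {r : ℝ} (hr : 0 < r) (s : Finset E) (hs : ∀ x ∈ s, ‖x‖ ≤ 1) :
    ∃ C : Finset E, (C.card : ℝ) ≤ (1 + 2 / r) ^ Module.finrank ℝ E ∧
      ∀ x ∈ s, ∃ c ∈ C, ‖x - c‖ ≤ r := by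
  classical
  -- A maximal separated subset is a net: a point farther than `r` from it could be added.
  obtain ⟨C, hC⟩ := (s.powerset.filter fun C =>
    ∀ c ∈ C, ∀ d ∈ C, c ≠ d → r ≤ ‖c - d‖).exists_maximal ⟨∅, by simp⟩
  have hCmem := hC.prop
  rw [Finset.mem_filter, Finset.mem_powerset] at hCmem
  obtain ⟨hCs, hsep⟩ := hCmem
  refine ⟨C, card_le_of_separated_unitBall hr C (fun c hc => hs c (hCs hc)) hsep, ?_⟩
  intro x hx
  by_contra! hfar
  have hxC : x ∉ C := fun hxC => by
    have := hfar x hxC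
    rw [sub_self, norm_zero] at this
    exact this.not_gt hr
  have hins : insert x C ∈ s.powerset.filter fun C =>
      ∀ c ∈ C, ∀ d ∈ C, c ≠ d → r ≤ ‖c - d‖ := by
    rw [Finset.mem_filter, Finset.mem_powerset]
    refine ⟨Finset.insert_subset hx hCs, ?_⟩
    intro c hc d hd hcd
    rcases Finset.mem_insert.1 hc with rfl | hc' <;> rcases Finset.mem_insert.1 hd with rfl | hd'
    · exact absurd rfl hcd
    · exact (hfar d hd').le
    · rw [norm_sub_rev]; exact (hfar c hc').le
    · exact hsep c hc' d hd' hcd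
  exact hxC (hC.le_of_ge hins (Finset.subset_insert x C) (Finset.mem_insert_self x C))

/-! ### The trace inequality behind the information ratio -/

/-- A weighted form of `|tr M| ≤ √(rank M) ‖M‖_F`. -/
theorem sq_sum_inner_le {E ι : Type*} [NormedAddCommGroup E] [InnerProductSpace ℝ E]
    [FiniteDimensional ℝ E] (s : Finset ι) (p : ι → ℝ) (hp : ∀ i ∈ s, 0 ≤ p i) (a v : ι → E) :
    (∑ i ∈ s, p i * inner ℝ (a i) (v i)) ^ 2 ≤
      Module.finrank ℝ E * ∑ i ∈ s, ∑ j ∈ s, p i * p j * inner ℝ (a j) (v i) ^ 2 := by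
  -- `Q` is the second moment operator of the `a j`. In its eigenbasis the right-hand side is a
  -- single sum over coordinates, so Cauchy–Schwarz over `i` in each coordinate, then over the
  -- coordinates, suffices; the latter produces the factor `finrank`.
  let Q : E →ₗ[ℝ] E := ∑ j ∈ s, p j • ((innerₗ E (a j)).smulRight (a j))
  have hQ : ∀ x y, inner ℝ (Q x) y = ∑ j ∈ s, p j * (inner ℝ (a j) x * inner ℝ (a j) y) := by
    intro x y
    simp [Q, LinearMap.sum_apply, sum_inner, inner_smul_left]
  have hsymm : Q.IsSymmetric := by
    intro x y
    rw [real_inner_comm (Q y) x, hQ, hQ]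
    exact Finset.sum_congr rfl fun j _ => by ring
  let b := hsymm.eigenvectorBasis rfl
  let q : Fin (Module.finrank ℝ E) → ℝ := hsymm.eigenvalues rfl
  have hbq : ∀ k, Q (b k) = q k • b k := fun k =>
    hsymm.apply_eigenvectorBasis rfl k
  have hqk : ∀ k, q k = ∑ j ∈ s, p j * inner ℝ (a j) (b k) ^ 2 := by
    intro k
    have h1 := hQ (b k) (b k)
    rw [hbq, inner_smul_left, real_inner_self_eq_norm_sq, b.orthonormal.1 k] at h1
    simpa [pow_two] using h1
  have hquad : ∀ x, ∑ j ∈ s, p j * inner ℝ (a j) x ^ 2 = ∑ k, q k * inner ℝ x (b k) ^ 2 := by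
    intro x
    have h1 := hQ x x
    have h2 : inner ℝ (Q x) x = ∑ k, q k * inner ℝ x (b k) ^ 2 := by
      rw [← b.sum_inner_mul_inner]
      refine Finset.sum_congr rfl fun k _ => ?_
      rw [hsymm x (b k), hbq, inner_smul_right, real_inner_comm (b k) x]
      ring
    rw [← h2, h1]
    exact Finset.sum_congr rfl fun j _ => by ring
  have hcs : ∀ k, (∑ i ∈ s, p i * (inner ℝ (a i) (b k) * inner ℝ (v i) (b k))) ^ 2 ≤
      q k * ∑ i ∈ s, p i * inner ℝ (v i) (b k) ^ 2 := by
    intro k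
    rw [hqk]
    refine Finset.sum_sq_le_sum_mul_sum_of_sq_le_mul s
      (fun i hi => mul_nonneg (hp i hi) (sq_nonneg _))
      (fun i hi => mul_nonneg (hp i hi) (sq_nonneg _)) (fun i _ => by apply le_of_eq; ring)
  have hsum : ∑ i ∈ s, p i * inner ℝ (a i) (v i) =
      ∑ k, ∑ i ∈ s, p i * (inner ℝ (a i) (b k) * inner ℝ (v i) (b k)) := by
    rw [Finset.sum_comm]
    refine Finset.sum_congr rfl fun i _ => ?_
    rw [← Finset.mul_sum, ← b.sum_inner_mul_inner (a i) (v i)]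
    simp_rw [real_inner_comm (b _) (v i)]
  calc (∑ i ∈ s, p i * inner ℝ (a i) (v i)) ^ 2
      ≤ Module.finrank ℝ E *
        ∑ k, (∑ i ∈ s, p i * (inner ℝ (a i) (b k) * inner ℝ (v i) (b k))) ^ 2 := by
        rw [hsum]
        simpa using sq_sum_le_card_mul_sum_sq (s := Finset.univ)
          (f := fun k => ∑ i ∈ s, p i * (inner ℝ (a i) (b k) * inner ℝ (v i) (b k)))
    _ ≤ Module.finrank ℝ E * ∑ k, q k * ∑ i ∈ s, p i * inner ℝ (v i) (b k) ^ 2 := by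
        gcongr with k
        exact hcs k
    _ = _ := by
        congr 1
        simp_rw [Finset.mul_sum]
        rw [Finset.sum_comm]
        refine Finset.sum_congr rfl fun i _ => ?_
        have := congrArg (p i * ·) (hquad (v i))
        simp only [Finset.mul_sum] at this
        rw [← Finset.sum_congr rfl fun j _ => (mul_assoc (p i) (p j) _).symm, this]
        exact Finset.sum_congr rfl fun k _ => by ring

/-! ### Exponential moments of bounded rewards -/

/-- Hoeffding's lemma for a law on `{-1/2, 1/2}` with mean `m`. -/
theorem hoeffding_two_point {m : ℝ} (hm : m ∈ Set.Icc (-(1 / 2) : ℝ) (1 / 2)) (l : ℝ) :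
    (1 / 2 - m) * Real.exp (-l / 2) + (1 / 2 + m) * Real.exp (l / 2) ≤
      Real.exp (l * m + l ^ 2 / 8) := by
  obtain ⟨h1, h2⟩ := hm
  let μ : Measure ℝ := ENNReal.ofReal (1 / 2 - m) • Measure.dirac (-(1 / 2)) +
    ENNReal.ofReal (1 / 2 + m) • Measure.dirac (1 / 2)
  have : IsProbabilityMeasure μ := ⟨by
    simp only [μ, Measure.coe_add, Measure.coe_smul, Pi.add_apply, Pi.smul_apply,
      measure_univ, smul_eq_mul, mul_one]
    rw [← ENNReal.ofReal_add (by linarith) (by linarith)]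
    norm_num⟩
  have hint : ∀ f : ℝ → ℝ, ∫ x, f x ∂μ = (1 / 2 - m) * f (-(1 / 2)) + (1 / 2 + m) * f (1 / 2) := by
    intro f
    have hi : ∀ (c x : ℝ), Integrable f (ENNReal.ofReal c • Measure.dirac x) := fun c x =>
      (integrable_dirac (by simp)).smul_measure ENNReal.ofReal_ne_top
    rw [integral_add_measure (hi _ _) (hi _ _), integral_smul_measure, integral_smul_measure,
      integral_dirac, integral_dirac, ENNReal.toReal_ofReal (by linarith),
      ENNReal.toReal_ofReal (by linarith)]
    simp
  have hmem : ∀ᵐ x ∂μ, id x ∈ Set.Icc (-(1 / 2) : ℝ) (1 / 2) := by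
    have h : ∀ (c x : ℝ), x ∈ Set.Icc (-(1 / 2) : ℝ) (1 / 2) →
        ∀ᵐ x ∂(ENNReal.ofReal c • Measure.dirac x), id x ∈ Set.Icc (-(1 / 2) : ℝ) (1 / 2) :=
      fun c x hx => Measure.ae_smul_measure (by rw [ae_dirac_eq]; exact hx) _
    rw [ae_add_measure_iff]
    exact ⟨h _ _ (by norm_num), h _ _ (by norm_num)⟩
  have hsg := (hasSubgaussianMGF_of_mem_Icc (X := id) (μ := μ) aemeasurable_id hmem).mgf_le l
  have hmean : ∫ x, id x ∂μ = m := by rw [hint]; simp; ring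
  rw [hmean, mgf, hint] at hsg
  simp only [id] at hsg
  have hc : (((‖(1 / 2 : ℝ) - -(1 / 2)‖₊ / 2) ^ 2 : NNReal) : ℝ) * l ^ 2 / 2 = l ^ 2 / 8 := by
    have : ‖(1 / 2 : ℝ) - -(1 / 2)‖₊ = 1 := by norm_num
    rw [this]; push_cast; ring
  rw [hc] at hsg
  have e1 : Real.exp (-l / 2) = Real.exp (l * (-(1 / 2) - m)) * Real.exp (l * m) := by
    rw [← Real.exp_add]; congr 1; ring
  have e2 : Real.exp (l / 2) = Real.exp (l * (1 / 2 - m)) * Real.exp (l * m) := by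
    rw [← Real.exp_add]; congr 1; ring
  rw [e1, e2, Real.exp_add]
  nlinarith [mul_le_mul_of_nonneg_right hsg (Real.exp_pos (l * m)).le]

/-- The chord bound for the exponential on `[-1/2, 1/2]`. -/
theorem exp_mul_le_chord {r : ℝ} (hr : r ∈ Set.Icc (-(1 / 2) : ℝ) (1 / 2)) (l : ℝ) :
    Real.exp (l * r) ≤ (1 / 2 - r) * Real.exp (-l / 2) + (1 / 2 + r) * Real.exp (l / 2) := by
  have h := convexOn_exp.2 (Set.mem_univ (-l / 2)) (Set.mem_univ (l / 2))
    (by linarith [hr.2] : (0 : ℝ) ≤ 1 / 2 - r) (by linarith [hr.1] : (0 : ℝ) ≤ 1 / 2 + r) (by ring)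
  simp only [smul_eq_mul] at h
  refine le_of_eq_of_le ?_ h
  congr 1
  ring

/-! ### Posterior means of cells and the regret of one round -/

section Cells

variable {E κ : Type*} [NormedAddCommGroup E] [InnerProductSpace ℝ E] [DecidableEq κ]

/-- The mean of the weights `p` on the finite set `s`. -/
def wmean (s : Finset E) (p : E → ℝ) : E := ∑ x ∈ s, p x • x

/-- The mean of the weights `p` on the finite set `s`, conditioned on the cell `c = k`. -/
def cellMean (s : Finset E) (c : E → κ) (p : E → ℝ) (k : κ) : E :=
  (∑ x ∈ s with c x = k, p x)⁻¹ • ∑ x ∈ s with c x = k, p x • x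

theorem sum_cell_smul_sub_cellMean {s : Finset E} {p : E → ℝ} (hp : ∀ x ∈ s, 0 ≤ p x)
    (c : E → κ) (k : κ) :
    ∑ x ∈ s with c x = k, p x • (x - cellMean s c p k) = 0 := by
  simp_rw [smul_sub, Finset.sum_sub_distrib, ← Finset.sum_smul]
  -- For a cell without mass `cellMean` is the default value `0`, harmless because every weight in
  -- the cell vanishes.
  by_cases h : ∑ x ∈ s with c x = k, p x = 0
  · have h0 := (Finset.sum_eq_zero_iff_of_nonneg
      (fun x hx => hp x (Finset.mem_filter.1 hx).1)).1 h
    rw [h, zero_smul, sub_zero]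
    exact Finset.sum_eq_zero fun x hx => by rw [h0 x hx, zero_smul]
  · rw [cellMean, smul_inv_smul₀ h, sub_self]

theorem sum_mul_inner_sub_cellMean {s : Finset E} {p : E → ℝ} (hp : ∀ x ∈ s, 0 ≤ p x)
    (c : E → κ) (u : κ → E) :
    ∑ x ∈ s, p x * inner ℝ (u (c x)) (x - cellMean s c p (c x)) = 0 := by
  rw [← Finset.sum_fiberwise_of_maps_to (t := s.image c) (g := c)
    (fun x hx => Finset.mem_image_of_mem c hx)]
  refine Finset.sum_eq_zero fun k _ => ?_
  calc ∑ x ∈ s with c x = k, p x * inner ℝ (u (c x)) (x - cellMean s c p (c x))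
      = inner ℝ (u k) (∑ x ∈ s with c x = k, p x • (x - cellMean s c p k)) := by
        rw [inner_sum]
        refine Finset.sum_congr rfl fun x hx => ?_
        rw [(Finset.mem_filter.1 hx).2, inner_smul_right]
    _ = 0 := by rw [sum_cell_smul_sub_cellMean hp, inner_zero_right]

theorem norm_wmean_le {s : Finset E} {p : E → ℝ} (hp : ∀ x ∈ s, 0 ≤ p x)
    (hp1 : ∑ x ∈ s, p x = 1) (hs : ∀ x ∈ s, ‖x‖ ≤ 1) : ‖wmean s p‖ ≤ 1 := by
  refine (norm_sum_le _ _).trans ?_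
  rw [← hp1]
  refine Finset.sum_le_sum fun x hx => ?_
  rw [norm_smul, Real.norm_of_nonneg (hp x hx)]
  exact mul_le_of_le_one_right (hp x hx) (hs x hx)

theorem norm_cellMean_le {s : Finset E} {p : E → ℝ} (hp : ∀ x ∈ s, 0 ≤ p x)
    (hs : ∀ x ∈ s, ‖x‖ ≤ 1) (c : E → κ) (k : κ) : ‖cellMean s c p k‖ ≤ 1 := by
  have h0 : 0 ≤ ∑ x ∈ s with c x = k, p x :=
    Finset.sum_nonneg fun x hx => hp x (Finset.mem_filter.1 hx).1
  have h1 : ‖∑ x ∈ s with c x = k, p x • x‖ ≤ ∑ x ∈ s with c x = k, p x := by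
    refine (norm_sum_le _ _).trans (Finset.sum_le_sum fun x hx => ?_)
    have hx' := (Finset.mem_filter.1 hx).1
    rw [norm_smul, Real.norm_of_nonneg (hp x hx')]
    exact mul_le_of_le_one_right (hp x hx') (hs x hx')
  rw [cellMean, norm_smul, norm_inv, Real.norm_of_nonneg h0]
  exact (mul_le_mul_of_nonneg_left h1 (inv_nonneg.2 h0)).trans (inv_mul_le_one_of_le₀ le_rfl h0)

/-- The cell mean minimizes the mean squared distance within the cell, hence does at least as well
as the net point. Passing through squares keeps the constant `r`, where the triangle inequality
would give `2 * r`. -/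
theorem sum_mul_norm_sub_cellMean_le [DecidableEq E] {s : Finset E} {p : E → ℝ} {r : ℝ}
    (hr : 0 ≤ r) (hp : ∀ x ∈ s, 0 ≤ p x) (hp1 : ∑ x ∈ s, p x = 1) (c : E → E)
    (hc : ∀ x ∈ s, ‖x - c x‖ ≤ r) :
    ∑ x ∈ s, p x * ‖x - cellMean s c p (c x)‖ ≤ r := by
  have h1 : (∑ x ∈ s, p x * ‖x - cellMean s c p (c x)‖) ^ 2 ≤
      (∑ x ∈ s, p x) * ∑ x ∈ s, p x * ‖x - cellMean s c p (c x)‖ ^ 2 :=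
    Finset.sum_sq_le_sum_mul_sum_of_sq_le_mul s hp
      (fun i hi => mul_nonneg (hp i hi) (sq_nonneg _)) (fun i _ => by apply le_of_eq; ring)
  have h2 : ∑ x ∈ s, p x * ‖x - cellMean s c p (c x)‖ ^ 2 ≤ ∑ x ∈ s, p x * ‖x - c x‖ ^ 2 := by
    have h0 := sum_mul_inner_sub_cellMean hp c fun k => cellMean s c p k - k
    have : ∑ x ∈ s, p x * ‖x - c x‖ ^ 2 =
        ∑ x ∈ s, p x * ‖x - cellMean s c p (c x)‖ ^ 2 +
        2 * ∑ x ∈ s, p x * inner ℝ (cellMean s c p (c x) - c x) (x - cellMean s c p (c x)) +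
        ∑ x ∈ s, p x * ‖cellMean s c p (c x) - c x‖ ^ 2 := by
      rw [Finset.mul_sum, ← Finset.sum_add_distrib, ← Finset.sum_add_distrib]
      refine Finset.sum_congr rfl fun x _ => ?_
      have : x - c x = (x - cellMean s c p (c x)) + (cellMean s c p (c x) - c x) := by abel
      rw [this, norm_add_sq_real, real_inner_comm]
      ring
    rw [this, h0]
    have : 0 ≤ ∑ x ∈ s, p x * ‖cellMean s c p (c x) - c x‖ ^ 2 :=
      Finset.sum_nonneg fun x hx => mul_nonneg (hp x hx) (sq_nonneg _)
    linarith
  have h3 : ∑ x ∈ s, p x * ‖x - c x‖ ^ 2 ≤ r ^ 2 := by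
    calc ∑ x ∈ s, p x * ‖x - c x‖ ^ 2 ≤ ∑ x ∈ s, p x * r ^ 2 :=
          Finset.sum_le_sum fun x hx => mul_le_mul_of_nonneg_left
            (pow_le_pow_left₀ (norm_nonneg _) (hc x hx) 2) (hp x hx)
      _ = r ^ 2 := by rw [← Finset.sum_mul, hp1, one_mul]
  rw [hp1, one_mul] at h1
  exact abs_le_of_sq_le_sq' ((h1.trans h2).trans h3) hr |>.2

/-- The information gained about the cell of the parameter in one round of Thompson sampling,
measured by squared differences of mean rewards. -/
def infoGain (s : Finset E) (c : E → κ) (α : E → E) (p : E → ℝ) : ℝ :=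
  ∑ x ∈ s, ∑ y ∈ s, p x * p y *
    (1 / 2 * inner ℝ (α y) (cellMean s c p (c x) - wmean s p)) ^ 2

/-- One-step regret of Thompson sampling under the posterior `p`, against the information gain. -/
theorem stepRegret_le [FiniteDimensional ℝ E] [DecidableEq E] {s : Finset E} {p : E → ℝ}
    {r η : ℝ} (hr : 0 ≤ r) (hη : 0 < η) (hp : ∀ x ∈ s, 0 ≤ p x) (hp1 : ∑ x ∈ s, p x = 1)
    (c α : E → E) (hc : ∀ x ∈ s, ‖x - c x‖ ≤ r) (hα : ∀ x ∈ s, ‖α x‖ ≤ 1) :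
    ∑ x ∈ s, p x * (1 / 2 * inner ℝ (α x) x) -
        ∑ x ∈ s, ∑ y ∈ s, p x * p y * (1 / 2 * inner ℝ (α y) x) ≤
      r / 2 + (η * (Module.finrank ℝ E * infoGain s c α p) + η⁻¹) / 2 := by
  set v : E → E := fun x => cellMean s c p (c x) - wmean s p with hv
  -- The played action is independent of the parameter under the posterior, so it meets only the
  -- overall mean.
  have hcross : ∑ x ∈ s, ∑ y ∈ s, p x * p y * (1 / 2 * inner ℝ (α y) x) =
      ∑ y ∈ s, p y * (1 / 2 * inner ℝ (α y) (wmean s p)) := by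
    rw [Finset.sum_comm]
    refine Finset.sum_congr rfl fun y _ => ?_
    rw [wmean, inner_sum, Finset.mul_sum, Finset.mul_sum]
    refine Finset.sum_congr rfl fun x _ => ?_
    rw [inner_smul_right]; ring
  have hsplit : ∑ x ∈ s, p x * (1 / 2 * inner ℝ (α x) x) -
        ∑ x ∈ s, ∑ y ∈ s, p x * p y * (1 / 2 * inner ℝ (α y) x) =
      1 / 2 * ∑ x ∈ s, p x * inner ℝ (α x) (x - cellMean s c p (c x)) +
      1 / 2 * ∑ x ∈ s, p x * inner ℝ (α x) (v x) := by
    rw [hcross, ← Finset.sum_sub_distrib, Finset.mul_sum, Finset.mul_sum, ← Finset.sum_add_distrib]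
    refine Finset.sum_congr rfl fun x _ => ?_
    simp only [hv, inner_sub_right]; ring
  have h1 : ∑ x ∈ s, p x * inner ℝ (α x) (x - cellMean s c p (c x)) ≤ r := by
    refine le_trans (Finset.sum_le_sum fun x hx => mul_le_mul_of_nonneg_left ?_ (hp x hx))
      (sum_mul_norm_sub_cellMean_le hr hp hp1 c hc)
    exact (real_inner_le_norm _ _).trans (mul_le_of_le_one_left (norm_nonneg _) (hα x hx))
  have h2 := sq_sum_inner_le s p hp α v
  have h3 : ∑ i ∈ s, ∑ j ∈ s, p i * p j * inner ℝ (α j) (v i) ^ 2 = 4 * infoGain s c α p := by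
    rw [infoGain, Finset.mul_sum]
    refine Finset.sum_congr rfl fun x _ => ?_
    rw [Finset.mul_sum]
    exact Finset.sum_congr rfl fun y _ => by ring
  rw [h3] at h2
  set S := ∑ x ∈ s, p x * inner ℝ (α x) (v x)
  -- The inequality `S ≤ η S² / 4 + η⁻¹` linearizes the square root, so that the bound can be summed
  -- over rounds and integrated without Jensen's inequality.
  have h4 : S ≤ η * (Module.finrank ℝ E * infoGain s c α p) + η⁻¹ := by
    have h5 : S ≤ η * S ^ 2 / 4 + η⁻¹ := by
      have : η * S ^ 2 / 4 + η⁻¹ - S = η⁻¹ * (η * S / 2 - 1) ^ 2 := by field_simp; ring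
      nlinarith [mul_nonneg (inv_pos.2 hη).le (sq_nonneg (η * S / 2 - 1))]
    nlinarith [mul_le_mul_of_nonneg_left h2 hη.le]
  rw [hsplit]
  linarith

end Cells

/-! ### Bounded measurable functions -/

/-- Bounded functions that are measurable with respect to `𝓖`. -/
def BddMeas {Ω : Type*} (𝓖 : MeasurableSpace Ω) (f : Ω → ℝ) : Prop :=
  Measurable[𝓖] f ∧ ∃ C, ∀ ω, |f ω| ≤ C

namespace BddMeas

variable {Ω : Type*} {𝓖 𝓗 : MeasurableSpace Ω} {f g : Ω → ℝ}

theorem const (c : ℝ) : BddMeas 𝓖 fun _ => c := ⟨measurable_const, |c|, fun _ => le_rfl⟩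

theorem mono (hf : BddMeas 𝓖 f) (h : 𝓖 ≤ 𝓗) : BddMeas 𝓗 f := ⟨hf.1.mono h le_rfl, hf.2⟩

theorem add (hf : BddMeas 𝓖 f) (hg : BddMeas 𝓖 g) : BddMeas 𝓖 fun ω => f ω + g ω := by
  obtain ⟨hf, C, hC⟩ := hf
  obtain ⟨hg, D, hD⟩ := hg
  exact ⟨hf.add hg, C + D, fun ω => (abs_add_le _ _).trans (add_le_add (hC ω) (hD ω))⟩

theorem mul (hf : BddMeas 𝓖 f) (hg : BddMeas 𝓖 g) : BddMeas 𝓖 fun ω => f ω * g ω := by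
  obtain ⟨hf, C, hC⟩ := hf
  obtain ⟨hg, D, hD⟩ := hg
  refine ⟨hf.mul hg, C * D, fun ω => ?_⟩
  rw [abs_mul]
  exact mul_le_mul (hC ω) (hD ω) (abs_nonneg _) ((abs_nonneg _).trans (hC ω))

theorem neg (hf : BddMeas 𝓖 f) : BddMeas 𝓖 fun ω => -f ω := by
  simpa using (const (-1)).mul hf

theorem sub (hf : BddMeas 𝓖 f) (hg : BddMeas 𝓖 g) : BddMeas 𝓖 fun ω => f ω - g ω := by
  simpa [sub_eq_add_neg] using hf.add hg.neg

theorem sq (hf : BddMeas 𝓖 f) : BddMeas 𝓖 fun ω => f ω ^ 2 := by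
  simpa [pow_two] using hf.mul hf

theorem div_const (hf : BddMeas 𝓖 f) (c : ℝ) : BddMeas 𝓖 fun ω => f ω / c := by
  simpa [div_eq_mul_inv] using hf.mul (const c⁻¹)

theorem exp (hf : BddMeas 𝓖 f) : BddMeas 𝓖 fun ω => Real.exp (f ω) := by
  obtain ⟨hf, C, hC⟩ := hf
  refine ⟨Real.measurable_exp.comp hf, Real.exp C, fun ω => ?_⟩
  rw [Real.abs_exp]
  exact Real.exp_le_exp.2 ((le_abs_self _).trans (hC ω))

theorem sum {ι : Type*} (s : Finset ι) {f : ι → Ω → ℝ} (hf : ∀ i ∈ s, BddMeas 𝓖 (f i)) :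
    BddMeas 𝓖 fun ω => ∑ i ∈ s, f i ω := by
  classical
  induction s using Finset.induction_on with
  | empty => simpa using const 0
  | insert i s hi ih =>
    simp_rw [Finset.sum_insert hi]
    exact (hf i (Finset.mem_insert_self i s)).add
      (ih fun j hj => hf j (Finset.mem_insert_of_mem hj))

theorem ite {q : Ω → Prop} [DecidablePred q] (hq : MeasurableSet[𝓖] {ω | q ω}) :
    BddMeas 𝓖 fun ω => if q ω then 1 else 0 :=
  ⟨Measurable.ite hq measurable_const measurable_const, 1, fun ω => by
    beta_reduce
    split_ifs <;> simp⟩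

theorem integrable [m : MeasurableSpace Ω] {P : Measure Ω} [IsFiniteMeasure P]
    (hf : BddMeas 𝓖 f) (h : 𝓖 ≤ m) : Integrable f P := by
  obtain ⟨hf, C, hC⟩ := hf
  exact Integrable.of_bound (hf.mono h le_rfl).aestronglyMeasurable C (ae_of_all _ hC)

/-- Evaluating a family of bounded measurable functions at a measurable random index that takes
finitely many values. -/
theorem eval {E : Type*} [MeasurableSpace E] [MeasurableSingletonClass E] {X : Ω → E}
    (hX : Measurable[𝓖] X) {s : Finset E} (hXs : ∀ ω, X ω ∈ s) {Φ : E → Ω → ℝ}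
    (hΦ : ∀ x ∈ s, BddMeas 𝓖 (Φ x)) : BddMeas 𝓖 fun ω => Φ (X ω) ω := by
  classical
  have h : (fun ω => Φ (X ω) ω) = fun ω => ∑ x ∈ s, (if X ω = x then 1 else 0) * Φ x ω := by
    funext ω
    simp [Finset.sum_ite_eq, hXs ω]
  rw [h]
  exact sum s fun x hx => (ite (hX (measurableSet_singleton x))).mul (hΦ x hx)

end BddMeas

/-! ### Posterior sampling relative to a filtration -/

/-- A sequential decision problem with linear mean rewards in which the action of each round is
sampled from the posterior law of the optimal action, in terms of the filtration `𝓕` generated by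
the history: `p t x` is the posterior probability of the parameter `x` before round `t`. -/
structure PosteriorSampling {E Ω : Type*} [NormedAddCommGroup E] [InnerProductSpace ℝ E]
    [MeasurableSpace E] [DecidableEq E] [m : MeasurableSpace Ω] (P : Measure Ω)
    (𝓕 : ℕ → MeasurableSpace Ω) (acts s : Finset E) (α : E → E) (θ : Ω → E) (A : ℕ → Ω → E)
    (R : ℕ → Ω → ℝ) (p : ℕ → E → Ω → ℝ) : Prop where
  le : ∀ t, 𝓕 t ≤ m
  mono : Monotone 𝓕
  norm_act_le : ∀ a ∈ acts, ‖a‖ ≤ 1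
  norm_param_le : ∀ x ∈ s, ‖x‖ ≤ 1
  opt_mem : ∀ x ∈ s, α x ∈ acts
  measurable_param : Measurable θ
  param_mem : ∀ ω, θ ω ∈ s
  measurable_act : ∀ t, Measurable[𝓕 (t + 1)] (A t)
  act_mem : ∀ t ω, A t ω ∈ acts
  measurable_reward : ∀ t, Measurable[𝓕 (t + 1)] (R t)
  reward_mem : ∀ t ω, R t ω ∈ Set.Icc (-(1 / 2) : ℝ) (1 / 2)
  measurable_post : ∀ t, ∀ x, Measurable[𝓕 t] (p t x)
  -- Required at every `ω`, not almost surely, so that the finite-dimensional inequalities apply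
  -- pointwise.
  post_nonneg : ∀ t x ω, 0 ≤ p t x ω
  sum_post : ∀ t ω, ∑ x ∈ s, p t x ω = 1
  integral_reward : ∀ t φ, BddMeas (𝓕 t) φ → ∀ a ∈ acts, ∀ x ∈ s,
    ∫ ω, φ ω * ((if A t ω = a then 1 else 0) * (if θ ω = x then 1 else 0)) * R t ω ∂P =
    ∫ ω, φ ω * ((if A t ω = a then 1 else 0) * (if θ ω = x then 1 else 0)) *
      (1 / 2 * inner ℝ a x) ∂P
  -- Tested form of two facts: given `𝓕 t`, action and parameter are independent, and the action has
  -- the posterior law of the optimal action.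
  integral_post : ∀ t φ, BddMeas (𝓕 t) φ → ∀ a ∈ acts, ∀ x ∈ s,
    ∫ ω, φ ω * ((if A t ω = a then 1 else 0) * (if θ ω = x then 1 else 0)) ∂P =
    ∫ ω, φ ω * (p t x ω * ∑ y ∈ s with α y = a, p t y ω) ∂P

namespace PosteriorSampling

variable {E Ω : Type*} [NormedAddCommGroup E] [InnerProductSpace ℝ E]

/-- The predicted mean reward of the action `a` in round `t`. -/
def predMean (s : Finset E) (p : ℕ → E → Ω → ℝ) (t : ℕ) (a : E) (ω : Ω) : ℝ :=
  1 / 2 * inner ℝ a (wmean s fun x => p t x ω)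

theorem sum_post_mul_predMean {s : Finset E} {p : ℕ → E → Ω → ℝ} (t : ℕ) (a : E) (ω : Ω) :
    ∑ x ∈ s, p t x ω * (1 / 2 * inner ℝ a x) = predMean s p t a ω := by
  rw [predMean, wmean, inner_sum, Finset.mul_sum]
  refine Finset.sum_congr rfl fun x _ => ?_
  rw [inner_smul_right]; ring

/-- The difference between the predicted mean reward of `a` in round `t` when the cell of the
parameter is revealed to be `k`, and the unconditional prediction. -/
def cellGap [DecidableEq E] (s : Finset E) (p : ℕ → E → Ω → ℝ) (c : E → E) (t : ℕ)
    (k a : E) (ω : Ω) : ℝ :=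
  1 / 2 * inner ℝ a (cellMean s c (fun x => p t x ω) k - wmean s fun x => p t x ω)

/-- The increment of the exponential weight of the cell `k` in a round in which the action `a`
yields the reward `r`. -/
def logWeightInc [DecidableEq E] (s : Finset E) (p : ℕ → E → Ω → ℝ) (c : E → E) (t : ℕ) (k a : E) (r : ℝ)
    (ω : Ω) : ℝ :=
  4 * cellGap s p c t k a ω * (r - predMean s p t a ω) - 2 * cellGap s p c t k a ω ^ 2

/-- The logarithm of the exponential weight of the cell `k` before round `t`. -/
def logWeight [DecidableEq E] (s : Finset E) (p : ℕ → E → Ω → ℝ) (c : E → E) (A : ℕ → Ω → E) (R : ℕ → Ω → ℝ)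
    (t : ℕ) (k : E) (ω : Ω) : ℝ :=
  ∑ u ∈ Finset.range t, logWeightInc s p c u k (A u ω) (R u ω) ω

variable [MeasurableSpace E] [DecidableEq E] [m : MeasurableSpace Ω] {P : Measure Ω}
    {𝓕 : ℕ → MeasurableSpace Ω} {acts s : Finset E} {α : E → E} {θ : Ω → E} {A : ℕ → Ω → E}
    {R : ℕ → Ω → ℝ} {p : ℕ → E → Ω → ℝ}

theorem bddMeas_post (h : PosteriorSampling P 𝓕 acts s α θ A R p) (t : ℕ) {x : E} (hx : x ∈ s) :
    BddMeas (𝓕 t) (p t x) := by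
  refine ⟨h.measurable_post t x, 1, fun ω => ?_⟩
  rw [abs_of_nonneg (h.post_nonneg t x ω), ← h.sum_post t ω]
  exact Finset.single_le_sum (f := fun x => p t x ω) (fun y _ => h.post_nonneg t y ω) hx

theorem bddMeas_reward (h : PosteriorSampling P 𝓕 acts s α θ A R p) (t : ℕ) :
    BddMeas (𝓕 (t + 1)) (R t) :=
  ⟨h.measurable_reward t, 1 / 2, fun ω => abs_le.2 (h.reward_mem t ω)⟩

/-- Splitting over the finitely many values of action and parameter extends `integral_reward` and
`integral_post`, stated for fixed `a` and `x`, to integrands evaluated at the random action and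
parameter, which are not `𝓕 t`-measurable. -/
theorem eval_eq_sum (h : PosteriorSampling P 𝓕 acts s α θ A R p) (t : ℕ) (Φ : E → E → Ω → ℝ)
    (ω : Ω) :
    Φ (A t ω) (θ ω) ω = ∑ a ∈ acts, ∑ x ∈ s,
      Φ a x ω * ((if A t ω = a then 1 else 0) * (if θ ω = x then 1 else 0)) := by
  simp [Finset.sum_ite_eq, h.act_mem t ω, h.param_mem ω]

theorem bddMeas_predMean (h : PosteriorSampling P 𝓕 acts s α θ A R p) (t : ℕ) (a : E) :
    BddMeas (𝓕 t) (predMean s p t a) := by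
  have e : predMean s p t a = fun ω => 1 / 2 * ∑ x ∈ s, p t x ω * inner ℝ a x := by
    funext ω
    simp [predMean, wmean, inner_sum, inner_smul_right]
  rw [e]
  exact (BddMeas.const _).mul
    (BddMeas.sum s fun x hx => (h.bddMeas_post t hx).mul (BddMeas.const _))

theorem bddMeas_cellGap (h : PosteriorSampling P 𝓕 acts s α θ A R p) (c : E → E) (t : ℕ)
    (k a : E) : BddMeas (𝓕 t) (cellGap s p c t k a) := by
  have e : cellGap s p c t k a = fun ω =>
      1 / 2 * inner ℝ a (cellMean s c (fun x => p t x ω) k) - predMean s p t a ω := by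
    funext ω
    simp [cellGap, predMean, inner_sub_right, mul_sub]
  rw [e]
  refine ((BddMeas.const _).mul ⟨?_, ‖a‖, fun ω => ?_⟩).sub (h.bddMeas_predMean t a)
  · simp only [cellMean, inner_smul_right, inner_sum]
    exact (Finset.measurable_sum _ fun x _ => h.measurable_post t x).inv.mul
      (Finset.measurable_sum _ fun x _ => (h.measurable_post t x).mul_const _)
  · refine (abs_real_inner_le_norm _ _).trans (mul_le_of_le_one_right (norm_nonneg _) ?_)
    exact norm_cellMean_le (fun x _ => h.post_nonneg t x ω) h.norm_param_le c k

theorem bddMeas_infoGain (h : PosteriorSampling P 𝓕 acts s α θ A R p) (c : E → E) (t : ℕ) :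
    BddMeas (𝓕 t) fun ω => infoGain s c α fun x => p t x ω :=
  BddMeas.sum s fun x hx => BddMeas.sum s fun y hy =>
    ((h.bddMeas_post t hx).mul (h.bddMeas_post t hy)).mul (h.bddMeas_cellGap c t (c x) (α y)).sq

theorem predMean_mem (h : PosteriorSampling P 𝓕 acts s α θ A R p) (t : ℕ) {a : E} (ha : a ∈ acts)
    (ω : Ω) : predMean s p t a ω ∈ Set.Icc (-(1 / 2) : ℝ) (1 / 2) := by
  have h1 : |inner ℝ a (wmean s fun x => p t x ω)| ≤ 1 :=
    (abs_real_inner_le_norm _ _).trans (mul_le_one₀ (h.norm_act_le a ha) (norm_nonneg _)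
      (norm_wmean_le (fun x _ => h.post_nonneg t x ω) (h.sum_post t ω) h.norm_param_le))
  rw [abs_le] at h1
  constructor <;> simp only [predMean] <;> linarith [h1.1, h1.2]

variable [MeasurableSingletonClass E]

theorem bddMeas_eval (h : PosteriorSampling P 𝓕 acts s α θ A R p) (t : ℕ) {Φ : E → E → Ω → ℝ}
    (hΦ : ∀ a ∈ acts, ∀ x ∈ s, BddMeas (𝓕 t) (Φ a x)) :
    BddMeas m fun ω => Φ (A t ω) (θ ω) ω :=
  BddMeas.eval (Φ := fun x ω => Φ (A t ω) x ω) h.measurable_param h.param_mem fun x hx =>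
    BddMeas.eval (Φ := fun a ω => Φ a x ω) ((h.measurable_act t).mono (h.le _) le_rfl)
      (h.act_mem t) fun a ha => (hΦ a ha x hx).mono (h.le t)

theorem bddMeas_indicator (h : PosteriorSampling P 𝓕 acts s α θ A R p) (t : ℕ) (a x : E) :
    BddMeas m fun ω => (if A t ω = a then 1 else 0) * (if θ ω = x then 1 else 0) :=
  (BddMeas.ite (((h.measurable_act t).mono (h.le _) le_rfl) (measurableSet_singleton a))).mul
    (BddMeas.ite (h.measurable_param (measurableSet_singleton x)))

theorem bddMeas_logWeight (h : PosteriorSampling P 𝓕 acts s α θ A R p) (c : E → E) (t : ℕ)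
    (k : E) : BddMeas (𝓕 t) (logWeight s p c A R t k) := by
  refine BddMeas.sum _ fun u hu => BddMeas.mono ?_ (h.mono (Finset.mem_range.1 hu))
  refine BddMeas.eval (Φ := fun a ω => logWeightInc s p c u k a (R u ω) ω)
    (h.measurable_act u) (h.act_mem u) fun a _ => ?_
  have hg := (h.bddMeas_cellGap c u k a).mono (h.mono u.le_succ)
  have hm := (h.bddMeas_predMean u a).mono (h.mono u.le_succ)
  exact (((BddMeas.const 4).mul hg).mul ((h.bddMeas_reward u).sub hm)).sub
    ((BddMeas.const 2).mul hg.sq)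

variable [IsProbabilityMeasure P]

theorem integral_eval_mul_reward (h : PosteriorSampling P 𝓕 acts s α θ A R p) (t : ℕ)
    {Φ : E → E → Ω → ℝ} (hΦ : ∀ a ∈ acts, ∀ x ∈ s, BddMeas (𝓕 t) (Φ a x)) :
    ∫ ω, Φ (A t ω) (θ ω) ω * R t ω ∂P =
      ∫ ω, Φ (A t ω) (θ ω) ω * (1 / 2 * inner ℝ (A t ω) (θ ω)) ∂P := by
  have hI : ∀ a ∈ acts, ∀ x ∈ s, BddMeas m fun ω =>
      Φ a x ω * ((if A t ω = a then 1 else 0) * (if θ ω = x then 1 else 0)) := fun a ha x hx =>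
    ((hΦ a ha x hx).mono (h.le t)).mul (h.bddMeas_indicator t a x)
  have hR := (h.bddMeas_reward t).mono (h.le _)
  have e1 : ∀ ω, Φ (A t ω) (θ ω) ω * R t ω = ∑ a ∈ acts, ∑ x ∈ s,
      Φ a x ω * ((if A t ω = a then 1 else 0) * (if θ ω = x then 1 else 0)) * R t ω := fun ω => by
    rw [h.eval_eq_sum t Φ ω]
    simp_rw [Finset.sum_mul]
  have e2 : ∀ ω, Φ (A t ω) (θ ω) ω * (1 / 2 * inner ℝ (A t ω) (θ ω)) = ∑ a ∈ acts, ∑ x ∈ s,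
      Φ a x ω * ((if A t ω = a then 1 else 0) * (if θ ω = x then 1 else 0)) *
        (1 / 2 * inner ℝ a x) := fun ω => by
    rw [h.eval_eq_sum t (fun a x ω => Φ a x ω * (1 / 2 * inner ℝ a x)) ω]
    exact Finset.sum_congr rfl fun a _ => Finset.sum_congr rfl fun x _ => by ring
  simp_rw [e1, e2]
  rw [integral_finsetSum _ fun a ha =>
      (BddMeas.sum s fun x hx => (hI a ha x hx).mul hR).integrable le_rfl,
    integral_finsetSum _ fun a ha =>
      (BddMeas.sum s fun x hx => (hI a ha x hx).mul (BddMeas.const _)).integrable le_rfl]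
  refine Finset.sum_congr rfl fun a ha => ?_
  rw [integral_finsetSum _ fun x hx => ((hI a ha x hx).mul hR).integrable le_rfl,
    integral_finsetSum _ fun x hx => ((hI a ha x hx).mul (BddMeas.const _)).integrable le_rfl]
  exact Finset.sum_congr rfl fun x hx => h.integral_reward t _ (hΦ a ha x hx) a ha x hx

theorem integral_eval (h : PosteriorSampling P 𝓕 acts s α θ A R p) (t : ℕ)
    {Φ : E → E → Ω → ℝ} (hΦ : ∀ a ∈ acts, ∀ x ∈ s, BddMeas (𝓕 t) (Φ a x)) :
    ∫ ω, Φ (A t ω) (θ ω) ω ∂P =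
      ∫ ω, ∑ x ∈ s, ∑ y ∈ s, p t x ω * p t y ω * Φ (α y) x ω ∂P := by
  have hI : ∀ a ∈ acts, ∀ x ∈ s, BddMeas m fun ω =>
      Φ a x ω * ((if A t ω = a then 1 else 0) * (if θ ω = x then 1 else 0)) := fun a ha x hx =>
    ((hΦ a ha x hx).mono (h.le t)).mul (h.bddMeas_indicator t a x)
  have hJ : ∀ a ∈ acts, ∀ x ∈ s, BddMeas (𝓕 t) fun ω =>
      Φ a x ω * (p t x ω * ∑ y ∈ s with α y = a, p t y ω) := fun a ha x hx =>
    (hΦ a ha x hx).mul ((h.bddMeas_post t hx).mul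
      (BddMeas.sum _ fun y hy => h.bddMeas_post t (Finset.mem_filter.1 hy).1))
  have e2 : ∀ ω, ∑ x ∈ s, ∑ y ∈ s, p t x ω * p t y ω * Φ (α y) x ω = ∑ a ∈ acts, ∑ x ∈ s,
      Φ a x ω * (p t x ω * ∑ y ∈ s with α y = a, p t y ω) := fun ω => by
    rw [Finset.sum_comm]
    rw [Finset.sum_comm (s := acts)]
    rw [Finset.sum_comm]
    refine Finset.sum_congr rfl fun x _ => ?_
    rw [← Finset.sum_fiberwise_of_maps_to h.opt_mem]
    refine Finset.sum_congr rfl fun a _ => ?_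
    rw [Finset.mul_sum, Finset.mul_sum]
    refine Finset.sum_congr rfl fun y hy => ?_
    rw [(Finset.mem_filter.1 hy).2]
    ring
  simp_rw [e2, h.eval_eq_sum t Φ]
  rw [integral_finsetSum _ fun a ha =>
      (BddMeas.sum s fun x hx => (hI a ha x hx)).integrable le_rfl,
    integral_finsetSum _ fun a ha =>
      (BddMeas.sum s fun x hx => (hJ a ha x hx)).integrable (h.le t)]
  refine Finset.sum_congr rfl fun a ha => ?_
  rw [integral_finsetSum _ fun x hx => (hI a ha x hx).integrable le_rfl,
    integral_finsetSum _ fun x hx => (hJ a ha x hx).integrable (h.le t)]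
  exact Finset.sum_congr rfl fun x hx => h.integral_post t _ (hΦ a ha x hx) a ha x hx

/-! ### Exponential weights and the total information gain -/

/-- The exponential weights are supermartingales (in expectation). -/
theorem integral_exp_logWeight_succ_le (h : PosteriorSampling P 𝓕 acts s α θ A R p) (c : E → E)
    (t : ℕ) (k : E) :
    ∫ ω, Real.exp (logWeight s p c A R (t + 1) k ω) ∂P ≤
      ∫ ω, Real.exp (logWeight s p c A R t k ω) ∂P := by
  let g := cellGap s p c t k
  let mn := predMean s p t
  let w : E → Ω → ℝ := fun a ω =>
    Real.exp (logWeight s p c A R t k ω) * Real.exp (-(4 * g a ω * mn a ω) - 2 * g a ω ^ 2)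
  -- `Ψ₀ + Ψ₁ r` is the chord majorant of the new weight. It is affine in the reward `r`, so only
  -- the conditional mean of the reward matters, and Hoeffding's lemma is needed only for the
  -- two-point law with that mean.
  let Ψ₀ : E → Ω → ℝ := fun a ω =>
    w a ω * (1 / 2 * (Real.exp (-(4 * g a ω) / 2) + Real.exp (4 * g a ω / 2)))
  let Ψ₁ : E → Ω → ℝ := fun a ω =>
    w a ω * (Real.exp (4 * g a ω / 2) - Real.exp (-(4 * g a ω) / 2))
  have hg : ∀ a, BddMeas (𝓕 t) (g a) := h.bddMeas_cellGap c t k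
  have h4g : ∀ a, BddMeas (𝓕 t) fun ω => 4 * g a ω := fun a => (BddMeas.const 4).mul (hg a)
  have hmn : ∀ a, BddMeas (𝓕 t) (mn a) := h.bddMeas_predMean t
  have hw : ∀ a, BddMeas (𝓕 t) (w a) := fun a => (h.bddMeas_logWeight c t k).exp.mul
    (((h4g a).mul (hmn a)).neg.sub ((BddMeas.const 2).mul (hg a).sq)).exp
  have hΨ₀ : ∀ a, BddMeas (𝓕 t) (Ψ₀ a) := fun a => (hw a).mul ((BddMeas.const _).mul
    (((h4g a).neg.div_const 2).exp.add ((h4g a).div_const 2).exp))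
  have hΨ₁ : ∀ a, BddMeas (𝓕 t) (Ψ₁ a) := fun a => (hw a).mul
    (((h4g a).div_const 2).exp.sub ((h4g a).neg.div_const 2).exp)
  have hR := (h.bddMeas_reward t).mono (h.le _)
  have i0 := (h.bddMeas_eval t (Φ := fun a _ => Ψ₀ a) fun a _ _ _ => hΨ₀ a)
  have i1 := (h.bddMeas_eval t (Φ := fun a _ => Ψ₁ a) fun a _ _ _ => hΨ₁ a)
  have i2 := (h.bddMeas_eval t (Φ := fun a x ω => Ψ₁ a ω * (1 / 2 * inner ℝ a x))
    fun a _ _ _ => (hΨ₁ a).mul (BddMeas.const _))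
  have h1 : ∀ ω, Real.exp (logWeight s p c A R (t + 1) k ω) ≤
      Ψ₀ (A t ω) ω + Ψ₁ (A t ω) ω * R t ω := by
    intro ω
    have e : Real.exp (logWeight s p c A R (t + 1) k ω) =
        w (A t ω) ω * Real.exp (4 * g (A t ω) ω * R t ω) := by
      simp only [w, ← Real.exp_add]
      congr 1
      rw [logWeight, Finset.sum_range_succ, ← logWeight, logWeightInc]
      ring
    have h2 := mul_le_mul_of_nonneg_left
      (exp_mul_le_chord (h.reward_mem t ω) (4 * g (A t ω) ω))
      (show 0 ≤ w (A t ω) ω from mul_nonneg (Real.exp_pos _).le (Real.exp_pos _).le)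
    rw [e]
    refine h2.trans (le_of_eq ?_)
    simp only [Ψ₀, Ψ₁]
    ring
  have h2 : ∀ ω, ∑ x ∈ s, ∑ y ∈ s, p t x ω * p t y ω *
      (Ψ₀ (α y) ω + Ψ₁ (α y) ω * (1 / 2 * inner ℝ (α y) x)) ≤
      Real.exp (logWeight s p c A R t k ω) := by
    intro ω
    have e : ∑ x ∈ s, ∑ y ∈ s, p t x ω * p t y ω *
        (Ψ₀ (α y) ω + Ψ₁ (α y) ω * (1 / 2 * inner ℝ (α y) x)) =
        ∑ y ∈ s, p t y ω * (Ψ₀ (α y) ω + Ψ₁ (α y) ω * mn (α y) ω) := by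
      rw [Finset.sum_comm]
      refine Finset.sum_congr rfl fun y _ => ?_
      have e1 : ∑ x ∈ s, p t x ω * (1 / 2 * inner ℝ (α y) x) = mn (α y) ω :=
        sum_post_mul_predMean t (α y) ω
      calc _ = p t y ω * (Ψ₀ (α y) ω * ∑ x ∈ s, p t x ω +
              Ψ₁ (α y) ω * ∑ x ∈ s, p t x ω * (1 / 2 * inner ℝ (α y) x)) := by
            simp only [Finset.mul_sum, ← Finset.sum_add_distrib]
            exact Finset.sum_congr rfl fun x _ => by ring
        _ = _ := by rw [e1, h.sum_post t ω, mul_one]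
    rw [e, ← one_mul (Real.exp (logWeight s p c A R t k ω)), ← h.sum_post t ω, Finset.sum_mul]
    refine Finset.sum_le_sum fun y hy => mul_le_mul_of_nonneg_left ?_ (h.post_nonneg t y ω)
    -- With exponent `4 g` the Hoeffding term is `(4 g)² / 8 = 2 g²`, exactly the compensator in
    -- `logWeightInc`.
    have hh := hoeffding_two_point (h.predMean_mem t (h.opt_mem y hy) ω) (4 * g (α y) ω)
    have h3 := mul_le_mul_of_nonneg_left hh
      (show 0 ≤ w (α y) ω from mul_nonneg (Real.exp_pos _).le (Real.exp_pos _).le)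
    have e3 : w (α y) ω * Real.exp (4 * g (α y) ω * predMean s p t (α y) ω +
        (4 * g (α y) ω) ^ 2 / 8) = Real.exp (logWeight s p c A R t k ω) := by
      simp only [w, ← Real.exp_add]
      congr 1
      simp only [mn]
      ring
    rw [e3] at h3
    refine le_trans (le_of_eq ?_) h3
    simp only [Ψ₀, Ψ₁, mn]
    ring
  calc ∫ ω, Real.exp (logWeight s p c A R (t + 1) k ω) ∂P
      ≤ ∫ ω, Ψ₀ (A t ω) ω + Ψ₁ (A t ω) ω * R t ω ∂P :=
        integral_mono ((h.bddMeas_logWeight c (t + 1) k).exp.integrable (h.le _))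
          ((i0.add (i1.mul hR)).integrable le_rfl) h1
    _ = ∫ ω, Ψ₀ (A t ω) ω + Ψ₁ (A t ω) ω * (1 / 2 * inner ℝ (A t ω) (θ ω)) ∂P := by
        rw [integral_add (i0.integrable le_rfl) ((i1.mul hR).integrable le_rfl),
          integral_add (i0.integrable le_rfl) (i2.integrable le_rfl),
          h.integral_eval_mul_reward t (Φ := fun a _ => Ψ₁ a) fun a _ _ _ => hΨ₁ a]
    _ = ∫ ω, ∑ x ∈ s, ∑ y ∈ s, p t x ω * p t y ω *
          (Ψ₀ (α y) ω + Ψ₁ (α y) ω * (1 / 2 * inner ℝ (α y) x)) ∂P :=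
        h.integral_eval t (Φ := fun a x ω => Ψ₀ a ω + Ψ₁ a ω * (1 / 2 * inner ℝ a x))
          fun a _ x _ => (hΨ₀ a).add ((hΨ₁ a).mul (BddMeas.const _))
    _ ≤ _ := by
        refine integral_mono (BddMeas.integrable (𝓖 := 𝓕 t) ?_ (h.le t))
          ((h.bddMeas_logWeight c t k).exp.integrable (h.le t)) h2
        exact BddMeas.sum s fun x hx => BddMeas.sum s fun y hy =>
          ((h.bddMeas_post t hx).mul (h.bddMeas_post t hy)).mul
            ((hΨ₀ _).add ((hΨ₁ _).mul (BddMeas.const _)))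

theorem integral_exp_logWeight_le_one (h : PosteriorSampling P 𝓕 acts s α θ A R p) (c : E → E)
    (t : ℕ) (k : E) : ∫ ω, Real.exp (logWeight s p c A R t k ω) ∂P ≤ 1 := by
  induction t with
  | zero => simp [logWeight]
  | succ t ih => exact (h.integral_exp_logWeight_succ_le c t k).trans ih

/-- The weight of the true cell grows at the rate of the information gain. -/
theorem integral_logWeightInc (h : PosteriorSampling P 𝓕 acts s α θ A R p) (c : E → E) (t : ℕ) :
    ∫ ω, logWeightInc s p c t (c (θ ω)) (A t ω) (R t ω) ω ∂P =
      2 * ∫ ω, infoGain s c α (fun x => p t x ω) ∂P := by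
  let Φ : E → E → Ω → ℝ := fun a x ω => 4 * cellGap s p c t (c x) a ω
  let Φ' : E → E → Ω → ℝ := fun a x ω =>
    Φ a x ω * predMean s p t a ω + 2 * cellGap s p c t (c x) a ω ^ 2
  have hΦ : ∀ a ∈ acts, ∀ x ∈ s, BddMeas (𝓕 t) (Φ a x) := fun a _ x _ =>
    (BddMeas.const 4).mul (h.bddMeas_cellGap c t _ _)
  have hΦ' : ∀ a ∈ acts, ∀ x ∈ s, BddMeas (𝓕 t) (Φ' a x) := fun a ha x hx =>
    ((hΦ a ha x hx).mul (h.bddMeas_predMean t a)).add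
      ((BddMeas.const 2).mul (h.bddMeas_cellGap c t _ _).sq)
  have hΦ'' : ∀ a ∈ acts, ∀ x ∈ s, BddMeas (𝓕 t) fun ω => Φ a x ω * (1 / 2 * inner ℝ a x) :=
    fun a ha x hx => (hΦ a ha x hx).mul (BddMeas.const _)
  have hR := (h.bddMeas_reward t).mono (h.le _)
  have i1 := h.bddMeas_eval t hΦ
  have i2 := h.bddMeas_eval t hΦ'
  have i3 := h.bddMeas_eval t (Φ := fun a x ω => Φ a x ω * (1 / 2 * inner ℝ a x)) hΦ''
  calc ∫ ω, logWeightInc s p c t (c (θ ω)) (A t ω) (R t ω) ω ∂P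
      = ∫ ω, Φ (A t ω) (θ ω) ω * R t ω - Φ' (A t ω) (θ ω) ω ∂P := by
        congr 1; funext ω
        simp only [logWeightInc, Φ, Φ']
        ring
    _ = ∫ ω, Φ (A t ω) (θ ω) ω * (1 / 2 * inner ℝ (A t ω) (θ ω)) - Φ' (A t ω) (θ ω) ω ∂P := by
        rw [integral_sub ((i1.mul hR).integrable le_rfl) (i2.integrable le_rfl),
          integral_sub (i3.integrable le_rfl) (i2.integrable le_rfl),
          h.integral_eval_mul_reward t hΦ]
    _ = ∫ ω, ∑ x ∈ s, ∑ y ∈ s, p t x ω * p t y ω *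
          (Φ (α y) x ω * (1 / 2 * inner ℝ (α y) x) - Φ' (α y) x ω) ∂P :=
        h.integral_eval t (Φ := fun a x ω => Φ a x ω * (1 / 2 * inner ℝ a x) - Φ' a x ω)
          fun a ha x hx => (hΦ'' a ha x hx).sub (hΦ' a ha x hx)
    _ = ∫ ω, 2 * infoGain s c α (fun x => p t x ω) ∂P := by
        congr 1; funext ω
        rw [infoGain, Finset.sum_comm]
        conv_rhs => rw [Finset.sum_comm]
        rw [Finset.mul_sum]
        refine Finset.sum_congr rfl fun y _ => ?_
        -- The expected reward minus its prediction is `g + ⟨α y, x - cellMean⟩ / 2`, so the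
        -- increment averages to `4 g² - 2 g² = 2 g²` plus a cross term. The cross term is linear in
        -- `x - cellMean` with a coefficient constant on cells, hence sums to zero.
        have h0 := sum_mul_inner_sub_cellMean (s := s) (p := fun x => p t x ω)
          (fun x _ => h.post_nonneg t x ω) c
          fun k => (2 * p t y ω * cellGap s p c t k (α y) ω) • α y
        rw [Finset.mul_sum, ← sub_eq_zero, ← Finset.sum_sub_distrib, ← h0]
        refine Finset.sum_congr rfl fun x _ => ?_
        simp only [Φ, Φ', cellGap, predMean, inner_sub_right, inner_smul_left, conj_trivial]
        ring
    _ = _ := integral_const_mul _ _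

/-- The total information gain is at most the logarithm of the number of cells. -/
theorem sum_integral_infoGain_le (h : PosteriorSampling P 𝓕 acts s α θ A R p) {c : E → E}
    {C : Finset E} (hC : ∀ x ∈ s, c x ∈ C) (T : ℕ) :
    ∑ t ∈ Finset.range T, ∫ ω, infoGain s c α (fun x => p t x ω) ∂P ≤
      Real.log C.card / 2 := by
  obtain ⟨ω₀⟩ : Nonempty Ω := nonempty_of_isProbabilityMeasure P
  have hN : (0 : ℝ) < C.card :=
    Nat.cast_pos.2 (Finset.card_pos.2 ⟨_, hC _ (h.param_mem ω₀)⟩)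
  have hinc : ∀ t, BddMeas m fun ω => logWeightInc s p c t (c (θ ω)) (A t ω) (R t ω) ω := by
    intro t
    have hR := (h.bddMeas_reward t).mono (h.le _)
    have i1 := h.bddMeas_eval t (Φ := fun a x ω => 4 * cellGap s p c t (c x) a ω)
      fun a _ x _ => (BddMeas.const 4).mul (h.bddMeas_cellGap c t _ _)
    have i2 := h.bddMeas_eval t (Φ := fun a x ω => predMean s p t a ω)
      fun a _ x _ => h.bddMeas_predMean t a
    have i3 := h.bddMeas_eval t (Φ := fun a x ω => 2 * cellGap s p c t (c x) a ω ^ 2)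
      fun a _ x _ => (BddMeas.const 2).mul (h.bddMeas_cellGap c t _ _).sq
    exact (i1.mul (hR.sub i2)).sub i3
  have hS : BddMeas m fun ω => logWeight s p c A R T (c (θ ω)) ω :=
    BddMeas.sum _ fun t _ => hinc t
  have hE : ∀ k, BddMeas m fun ω => Real.exp (logWeight s p c A R T k ω) := fun k =>
    (h.bddMeas_logWeight c T k).exp.mono (h.le T)
  -- The tangent bound `log y ≤ y / N + log N - 1` at `N = |C|` plays the part of Jensen's
  -- inequality; it loses nothing once the mean of the sum of weights is bounded by `N`.
  have hpt : ∀ ω, logWeight s p c A R T (c (θ ω)) ω ≤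
      (∑ k ∈ C, Real.exp (logWeight s p c A R T k ω)) * (C.card : ℝ)⁻¹ +
        (Real.log C.card - 1) := by
    intro ω
    have h1 := Real.add_one_le_exp (logWeight s p c A R T (c (θ ω)) ω - Real.log C.card)
    rw [Real.exp_sub, Real.exp_log hN, div_eq_mul_inv] at h1
    have h2 : Real.exp (logWeight s p c A R T (c (θ ω)) ω) ≤
        ∑ k ∈ C, Real.exp (logWeight s p c A R T k ω) :=
      Finset.single_le_sum (f := fun k => Real.exp (logWeight s p c A R T k ω))
        (fun k _ => (Real.exp_pos _).le) (hC _ (h.param_mem ω))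
    have h3 := mul_le_mul_of_nonneg_right h2 (inv_pos.2 hN).le
    linarith
  have hsum : ∫ ω, logWeight s p c A R T (c (θ ω)) ω ∂P =
      2 * ∑ t ∈ Finset.range T, ∫ ω, infoGain s c α (fun x => p t x ω) ∂P := by
    simp only [logWeight]
    rw [integral_finsetSum _ fun t _ => (hinc t).integrable le_rfl, Finset.mul_sum]
    exact Finset.sum_congr rfl fun t _ => h.integral_logWeightInc c t
  have hmain := integral_mono (hS.integrable le_rfl) (((BddMeas.sum C fun k _ => hE k).mul
    (BddMeas.const _)).add (BddMeas.const _) |>.integrable (P := P) le_rfl) hpt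
  rw [integral_add (((BddMeas.sum C fun k _ => hE k).mul (BddMeas.const _)).integrable le_rfl)
    (integrable_const _), integral_mul_const,
    integral_finsetSum _ fun k _ => (hE k).integrable le_rfl, integral_const, hsum] at hmain
  have hle : ∑ k ∈ C, ∫ ω, Real.exp (logWeight s p c A R T k ω) ∂P ≤ C.card := by
    refine (Finset.sum_le_sum fun k _ => h.integral_exp_logWeight_le_one c T k).trans ?_
    simp
  have h4 := mul_le_mul_of_nonneg_right hle (inv_pos.2 hN).le
  rw [mul_inv_cancel₀ hN.ne'] at h4
  simp only [probReal_univ, one_smul] at hmain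
  linarith

/-- Regret bound in terms of a partition of the parameters into cells of radius `r`. -/
theorem integral_regret_le [FiniteDimensional ℝ E] (h : PosteriorSampling P 𝓕 acts s α θ A R p)
    {c : E → E} {C : Finset E} (hC : ∀ x ∈ s, c x ∈ C) {r η : ℝ} (hr : 0 ≤ r) (hη : 0 < η)
    (hc : ∀ x ∈ s, ‖x - c x‖ ≤ r) (T : ℕ) :
    ∫ ω, ∑ t ∈ Finset.range T, (1 / 2 * inner ℝ (α (θ ω)) (θ ω) - R t ω) ∂P ≤
      T * (r / 2) + (η * (Module.finrank ℝ E * (Real.log C.card / 2)) + T * η⁻¹) / 2 := by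
  have hopt : ∀ t, BddMeas m fun ω => 1 / 2 * inner ℝ (α (θ ω)) (θ ω) := fun t =>
    h.bddMeas_eval t (Φ := fun _ x _ => 1 / 2 * inner ℝ (α x) x) fun _ _ _ _ => BddMeas.const _
  have hR := fun t => (h.bddMeas_reward t).mono (h.le _)
  have hG := fun t => (h.bddMeas_infoGain c t).integrable (P := P) (h.le t)
  have hstep : ∀ t, ∫ ω, (1 / 2 * inner ℝ (α (θ ω)) (θ ω) - R t ω) ∂P ≤
      r / 2 + (η * (Module.finrank ℝ E * ∫ ω, infoGain s c α (fun x => p t x ω) ∂P) + η⁻¹) / 2 := by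
    intro t
    have hb : ∀ a ∈ acts, ∀ x ∈ s, BddMeas (𝓕 t) fun _ =>
        1 / 2 * inner ℝ (α x) x - 1 / 2 * inner ℝ a x := fun _ _ _ _ => BddMeas.const _
    have e1 : ∫ ω, (1 / 2 * inner ℝ (α (θ ω)) (θ ω) - R t ω) ∂P =
        ∫ ω, (1 / 2 * inner ℝ (α (θ ω)) (θ ω) - 1 / 2 * inner ℝ (A t ω) (θ ω)) ∂P := by
      have := h.integral_eval_mul_reward t (Φ := fun _ _ _ => 1) fun _ _ _ _ => BddMeas.const 1
      simp only [one_mul] at this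
      rw [integral_sub ((hopt t).integrable le_rfl) ((hR t).integrable le_rfl),
        integral_sub ((hopt t).integrable le_rfl) ((h.bddMeas_eval t
          (Φ := fun a x _ => 1 / 2 * inner ℝ a x)
          fun _ _ _ _ => BddMeas.const _).integrable le_rfl), this]
    rw [e1, h.integral_eval t (Φ := fun a x _ => 1 / 2 * inner ℝ (α x) x - 1 / 2 * inner ℝ a x) hb]
    have hrhs : ∫ ω, (r / 2 + (η * (Module.finrank ℝ E *
        infoGain s c α (fun x => p t x ω)) + η⁻¹) / 2) ∂P =
        r / 2 + (η * (Module.finrank ℝ E * ∫ ω, infoGain s c α (fun x => p t x ω) ∂P) + η⁻¹) / 2 := by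
      have hI := ((hG t).const_mul (Module.finrank ℝ E : ℝ)).const_mul η
      have hI' : Integrable (fun ω => (η * (Module.finrank ℝ E *
          infoGain s c α (fun x => p t x ω)) + η⁻¹) / 2) P :=
        (hI.add (integrable_const _)).div_const _
      rw [integral_add (integrable_const _) hI',
        integral_div 2 fun ω => η * (Module.finrank ℝ E * infoGain s c α (fun x => p t x ω)) + η⁻¹,
        integral_add hI (integrable_const _), integral_const_mul, integral_const_mul]
      simp
    rw [← hrhs]
    refine integral_mono (BddMeas.integrable (𝓖 := 𝓕 t) ?_ (h.le t)) ?_ fun ω => ?_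
    · exact BddMeas.sum s fun x hx => BddMeas.sum s fun y hy =>
        ((h.bddMeas_post t hx).mul (h.bddMeas_post t hy)).mul (BddMeas.const _)
    · exact (integrable_const _).add
        ((((hG t).const_mul _).const_mul _).add (integrable_const _) |>.div_const _)
    · refine le_trans (le_of_eq ?_) (stepRegret_le (p := fun x => p t x ω) hr hη
        (fun x _ => h.post_nonneg t x ω) (h.sum_post t ω) c α hc
        fun x hx => h.norm_act_le _ (h.opt_mem x hx))
      simp only [mul_sub, Finset.sum_sub_distrib]
      congr 1
      refine Finset.sum_congr rfl fun x _ => ?_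
      rw [← Finset.sum_mul, ← Finset.mul_sum, h.sum_post t ω, mul_one]
  rw [integral_finsetSum _ fun t _ => ((hopt t).sub (hR t)).integrable le_rfl]
  refine (Finset.sum_le_sum fun t _ => hstep t).trans ?_
  have hinfo := h.sum_integral_infoGain_le hC T
  rw [Finset.sum_add_distrib, ← Finset.sum_div _ (fun t => η * (Module.finrank ℝ E *
    ∫ ω, infoGain s c α (fun x => p t x ω) ∂P) + η⁻¹), Finset.sum_add_distrib, ← Finset.mul_sum,
    ← Finset.mul_sum]
  simp only [Finset.sum_const, Finset.card_range, nsmul_eq_mul]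
  gcongr

end PosteriorSampling

/-! ### Independence and posterior probabilities -/

/-- Both hypotheses together say that the joint law is a triple product, so this is associativity of
product measures. -/
theorem indepFun_prodMk_right {Ω α β γ : Type*} [MeasurableSpace Ω] [MeasurableSpace α]
    [MeasurableSpace β] [MeasurableSpace γ] {P : Measure Ω} [IsFiniteMeasure P]
    {X : Ω → α} {Y : Ω → β} {Z : Ω → γ} (hX : Measurable X) (hY : Measurable Y)
    (hZ : Measurable Z) (hXY : IndepFun X Y P) (hXYZ : IndepFun (fun ω => (X ω, Y ω)) Z P) :
    IndepFun X (fun ω => (Y ω, Z ω)) P := by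
  have hYZ : IndepFun Y Z P := hXYZ.comp measurable_snd measurable_id
  rw [indepFun_iff_map_prod_eq_prod_map_map (hX.prodMk hY).aemeasurable hZ.aemeasurable] at hXYZ
  rw [indepFun_iff_map_prod_eq_prod_map_map hX.aemeasurable hY.aemeasurable] at hXY
  rw [indepFun_iff_map_prod_eq_prod_map_map hY.aemeasurable hZ.aemeasurable] at hYZ
  rw [indepFun_iff_map_prod_eq_prod_map_map hX.aemeasurable (hY.prodMk hZ).aemeasurable, hYZ,
    ← Measure.prodAssoc_prod, ← hXY, ← hXYZ,
    Measure.map_map MeasurableEquiv.prodAssoc.measurable ((hX.prodMk hY).prodMk hZ)]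
  rfl

theorem iIndepFun.indepFun_past {Ω β : Type*} [MeasurableSpace Ω] [MeasurableSpace β]
    {P : Measure Ω} {X : ℕ → Ω → β} (hX : iIndepFun X P) (hm : ∀ t, Measurable (X t)) (t : ℕ) :
    IndepFun (X t) (fun ω (i : Fin t) => X i ω) P := by
  have h := hX.indepFun_finset {t} (Finset.range t) (by simp) hm
  have h1 : Measurable fun f : ({t} : Finset ℕ) → β => f ⟨t, by simp⟩ :=
    measurable_pi_apply _
  have h2 : Measurable fun (f : ↥(Finset.range t) → β) (i : Fin t) =>
      f ⟨i, Finset.mem_range.2 i.2⟩ :=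
    measurable_pi_iff.2 fun i => measurable_pi_apply _
  exact h.comp h1 h2

theorem IndepFun.of_measurable_comap {Ω α β γ : Type*} [MeasurableSpace Ω] [MeasurableSpace α]
    [mβ : MeasurableSpace β] [MeasurableSpace γ] {P : Measure Ω} {X : Ω → α} {Y : Ω → β}
    {Z : Ω → γ} (h : IndepFun X Y P) (hZ : Measurable[mβ.comap Y] Z) : IndepFun X Z P :=
  indep_of_indep_of_le_right h hZ.comap_le

section CondExp

variable {Ω : Type*} {𝓖 : MeasurableSpace Ω} [m : MeasurableSpace Ω] {P : Measure Ω}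
  [IsProbabilityMeasure P]

theorem integral_mul_condExp (h𝓖 : 𝓖 ≤ m) {φ f : Ω → ℝ} (hφ : BddMeas 𝓖 φ)
    (hf : Integrable f P) : ∫ ω, φ ω * (P[f | 𝓖]) ω ∂P = ∫ ω, φ ω * f ω ∂P := by
  obtain ⟨hφ, C, hC⟩ := hφ
  have h := condExp_stronglyMeasurable_mul_of_bound h𝓖 hφ.stronglyMeasurable hf C
    (ae_of_all _ hC)
  calc ∫ ω, φ ω * (P[f | 𝓖]) ω ∂P = ∫ ω, (P[φ * f | 𝓖]) ω ∂P :=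
        integral_congr_ae h.symm
    _ = ∫ ω, φ ω * f ω ∂P := integral_condExp h𝓖

/-- A random variable with finitely many values has a posterior probability mass function that is
normalized everywhere. -/
theorem exists_posterior {E : Type*} [MeasurableSpace E] [MeasurableSingletonClass E]
    [DecidableEq E] (h𝓖 : 𝓖 ≤ m) {s : Finset E} {θ : Ω → E} (hθ : Measurable θ)
    (hs : ∀ ω, θ ω ∈ s) :
    ∃ p : E → Ω → ℝ, (∀ x, Measurable[𝓖] (p x)) ∧ (∀ x ω, 0 ≤ p x ω) ∧
      (∀ ω, ∑ x ∈ s, p x ω = 1) ∧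
      ∀ φ, BddMeas 𝓖 φ → ∀ x ∈ s,
        ∫ ω, φ ω * (if θ ω = x then 1 else 0) ∂P = ∫ ω, φ ω * p x ω ∂P := by
  classical
  obtain ⟨ω₀⟩ : Nonempty Ω := nonempty_of_isProbabilityMeasure P
  let f : E → Ω → ℝ := fun x ω => if θ ω = x then 1 else 0
  have hf : ∀ x, Integrable (f x) P := fun x =>
    (BddMeas.ite (hθ (measurableSet_singleton x))).integrable le_rfl
  let q : E → Ω → ℝ := fun x => P[f x | 𝓖]
  have hq : ∀ x, Measurable[𝓖] (q x) := fun x => stronglyMeasurable_condExp.measurable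
  let G : Set Ω := {ω | (∀ x ∈ s, 0 ≤ q x ω) ∧ ∑ x ∈ s, q x ω = 1}
  have hG : MeasurableSet[𝓖] G := by
    refine MeasurableSet.inter ?_ ?_
    · have : {ω | ∀ x ∈ s, 0 ≤ q x ω} = ⋂ x ∈ s, q x ⁻¹' Set.Ici 0 := by ext; simp
      change MeasurableSet[𝓖] {ω | ∀ x ∈ s, 0 ≤ q x ω}
      rw [this]
      exact Finset.measurableSet_biInter s fun x _ => hq x measurableSet_Ici
    · exact (Finset.measurable_sum s fun x _ => hq x) (measurableSet_singleton (1 : ℝ))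
  have hGae : ∀ᵐ ω ∂P, ω ∈ G := by
    have h1 : ∀ᵐ ω ∂P, ∀ x ∈ s, 0 ≤ q x ω := by
      rw [Finset.eventually_all]
      intro x _
      refine condExp_nonneg (ae_of_all _ fun ω => ?_)
      simp only [f, Pi.zero_apply]
      split_ifs <;> simp
    have h2 : ∀ᵐ ω ∂P, ∑ x ∈ s, q x ω = 1 := by
      have h3 := condExp_finsetSum (s := s) (fun x _ => hf x) 𝓖
      have h4 : ∑ x ∈ s, f x = fun _ => (1 : ℝ) := by
        funext ω
        simp [f, Finset.sum_apply, hs ω]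
      rw [h4, condExp_const h𝓖] at h3
      filter_upwards [h3] with ω hω
      simpa [q, Finset.sum_apply] using hω.symm
    filter_upwards [h1, h2] with ω h1 h2 using ⟨h1, h2⟩
  -- On the null set where the conditional expectations fail to form a probability vector, a point
  -- mass at an actual value of `θ` takes over. The absolute value gives nonnegativity also for `x ∉
  -- s`, which `G` does not control.
  refine ⟨fun x ω => if ω ∈ G then |q x ω| else if x = θ ω₀ then 1 else 0, ?_, ?_, ?_, ?_⟩
  · exact fun x => Measurable.ite hG (measurable_norm.comp (hq x)) measurable_const
  · intro x ω
    beta_reduce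
    split_ifs <;> positivity
  · intro ω
    by_cases hω : ω ∈ G
    · simp only [hω, if_true]
      rw [← hω.2]
      exact Finset.sum_congr rfl fun x hx => abs_of_nonneg (hω.1 x hx)
    · simp [hω, hs ω₀]
  · intro φ hφ x hx
    rw [← integral_mul_condExp h𝓖 hφ (hf x)]
    refine integral_congr_ae ?_
    filter_upwards [hGae] with ω hω
    simp [hω, q, abs_of_nonneg (hω.1 x hx)]

end CondExp

/-! ### From the bandit model to posterior sampling -/

section Model

variable {d : ℕ} {𝒲 Ξ Ω : Type*} [MeasurableSpace 𝒲] [MeasurableSpace Ξ]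
  {B : Bandit d 𝒲} {π : Policy B Ξ} {θ : Ω → EuclideanSpace ℝ (Fin d)} {W : ℕ → Ω → 𝒲}
  {ξ : ℕ → Ω → Ξ}

theorem measurable_action {𝓖 : MeasurableSpace Ω} {t : ℕ}
    (hH : Measurable[𝓖] (history B π θ W ξ t)) (hξ : Measurable[𝓖] (ξ t)) :
    Measurable[𝓖] (action B π θ W ξ t) :=
  (π.measurable_act t).comp (hH.prodMk hξ)

theorem bddMeas_reward (hlin : B.IsLinear) {𝓖 : MeasurableSpace Ω} {t : ℕ}
    (hθ : Measurable[𝓖] θ) (hθm : ∀ ω, θ ω ∈ B.params)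
    (hA : Measurable[𝓖] (action B π θ W ξ t)) (hW : Measurable[𝓖] (W t)) :
    BddMeas 𝓖 (reward B π θ W ξ t) := by
  refine BddMeas.eval (Φ := fun x ω => B.g (action B π θ W ξ t ω) x (W t ω)) hθ hθm fun x hx => ?_
  refine BddMeas.eval (Φ := fun a ω => B.g a x (W t ω)) hA (fun ω => π.act_mem t _ _) fun a ha => ?_
  exact ⟨(B.measurable_g a ha x hx).comp hW, 1 / 2,
    fun ω => abs_le.2 (hlin.reward_mem a ha x hx (W t ω))⟩

theorem measurable_history (hlin : B.IsLinear) {𝓖 : MeasurableSpace Ω} (hθ : Measurable[𝓖] θ)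
    (hθm : ∀ ω, θ ω ∈ B.params) (t : ℕ) (hW : ∀ i < t, Measurable[𝓖] (W i))
    (hξ : ∀ i < t, Measurable[𝓖] (ξ i)) : Measurable[𝓖] (history B π θ W ξ t) := by
  induction t with
  | zero => exact measurable_pi_iff.2 fun i => i.elim0
  | succ t ih =>
    have hH := ih (fun i hi => hW i (hi.trans t.lt_succ_self))
      fun i hi => hξ i (hi.trans t.lt_succ_self)
    have hA := measurable_action hH (hξ t t.lt_succ_self)
    have hR := (bddMeas_reward hlin hθ hθm hA (hW t t.lt_succ_self)).1
    refine measurable_pi_iff.2 fun i => ?_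
    induction i using Fin.lastCases with
    | last => simpa [history, action, reward] using! hA.prodMk hR
    | cast i => simpa [history] using! (measurable_pi_apply i).comp hH

/-- The information available before period `t`. -/
abbrev pastInfo (B : Bandit d 𝒲) (π : Policy B Ξ) (θ : Ω → EuclideanSpace ℝ (Fin d))
    (W : ℕ → Ω → 𝒲) (ξ : ℕ → Ω → Ξ) (t : ℕ) : MeasurableSpace Ω :=
  MeasurableSpace.comap (history B π θ W ξ t) inferInstance

theorem measurable_history_pastInfo (t : ℕ) :
    Measurable[pastInfo B π θ W ξ t] (history B π θ W ξ t) := comap_measurable _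

theorem pastInfo_mono : Monotone (pastInfo B π θ W ξ) := by
  refine monotone_nat_of_le_succ fun t => ?_
  have h : history B π θ W ξ t = (fun h (i : Fin t) => h i.castSucc) ∘ history B π θ W ξ (t + 1) := by
    funext ω i
    simp [history]
  refine Measurable.comap_le ?_
  rw [h]
  exact (measurable_pi_iff.2 fun i => measurable_pi_apply _).comp (measurable_history_pastInfo _)

theorem measurable_action_reward_pastInfo (t : ℕ) :
    Measurable[pastInfo B π θ W ξ (t + 1)]
      fun ω => (action B π θ W ξ t ω, reward B π θ W ξ t ω) := by
  have h : (fun ω => (action B π θ W ξ t ω, reward B π θ W ξ t ω)) =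
      (fun h => h (Fin.last t)) ∘ history B π θ W ξ (t + 1) := by
    funext ω
    simp [history, action, reward]
  rw [h]
  exact (measurable_pi_apply _).comp (measurable_history_pastInfo _)

variable [m : MeasurableSpace Ω] {P : Measure Ω}

theorem IsModel.pastInfo_le (h : IsModel B P θ W ξ) (hlin : B.IsLinear) (t : ℕ) :
    pastInfo B π θ W ξ t ≤ m :=
  (measurable_history hlin h.measurable_param h.param_mem t (fun i _ => h.measurable_noise i)
    fun i _ => h.measurable_algNoise i).comap_le

variable [IsProbabilityMeasure P]

/-- The model states mutual independence in layers. Regrouping them isolates `W t` from everything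
that determines the history, the parameter and the action of period `t`. -/
theorem IsModel.indepFun_noise_past (h : IsModel B P θ W ξ) (t : ℕ) :
    IndepFun (W t) (fun ω => (((fun i : Fin t => W i ω), θ ω), fun n => ξ n ω)) P := by
  have hpast : Measurable fun ω (i : Fin t) => W i ω :=
    measurable_pi_iff.2 fun i => h.measurable_noise i
  have hξ : Measurable fun ω n => ξ n ω := measurable_pi_iff.2 h.measurable_algNoise
  have hsplit : Measurable fun (w : ℕ → 𝒲) => (w t, fun i : Fin t => w i) :=
    (measurable_pi_apply t).prodMk (measurable_pi_iff.2 fun i => measurable_pi_apply _)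
  refine indepFun_prodMk_right (h.measurable_noise t) (hpast.prodMk h.measurable_param) hξ ?_ ?_
  · exact indepFun_prodMk_right (h.measurable_noise t) hpast h.measurable_param
      (iIndepFun.indepFun_past h.iIndepFun_noise h.measurable_noise t)
      (h.indepFun_param_noise.symm.comp hsplit measurable_id)
  · have hg : Measurable fun z : EuclideanSpace ℝ (Fin d) × (ℕ → 𝒲) =>
        (z.2 t, ((fun i : Fin t => z.2 i), z.1)) := by fun_prop
    exact h.indepFun_algNoise.comp hg measurable_id

theorem IsModel.indepFun_algNoise_past (h : IsModel B P θ W ξ) (t : ℕ) :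
    IndepFun (ξ t) (fun ω => ((fun i : Fin t => ξ i ω), (θ ω, fun n => W n ω))) P := by
  have hpast : Measurable fun ω (i : Fin t) => ξ i ω :=
    measurable_pi_iff.2 fun i => h.measurable_algNoise i
  have hsplit : Measurable fun (w : ℕ → Ξ) => (w t, fun i : Fin t => w i) :=
    (measurable_pi_apply t).prodMk (measurable_pi_iff.2 fun i => measurable_pi_apply _)
  exact indepFun_prodMk_right (h.measurable_algNoise t) hpast
    (h.measurable_param.prodMk (measurable_pi_iff.2 h.measurable_noise))
    (iIndepFun.indepFun_past h.iIndepFun_algNoise h.measurable_algNoise t)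
    (h.indepFun_algNoise.symm.comp hsplit measurable_id)

-- `φ` and the indicators are functions of variables independent of `W t`, and on the event they
-- select the reward is `B.g a x (W t)`; the expectation therefore factorizes.
open Classical in
theorem IsModel.integral_reward (h : IsModel B P θ W ξ) (hlin : B.IsLinear) (t : ℕ) {φ : Ω → ℝ}
    (hφ : BddMeas (pastInfo B π θ W ξ t) φ) {a x : EuclideanSpace ℝ (Fin d)}
    (ha : a ∈ B.actions) (hx : x ∈ B.params) :
    ∫ ω, φ ω * ((if action B π θ W ξ t ω = a then 1 else 0) * (if θ ω = x then 1 else 0)) *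
      reward B π θ W ξ t ω ∂P =
    ∫ ω, φ ω * ((if action B π θ W ξ t ω = a then 1 else 0) * (if θ ω = x then 1 else 0)) *
      (1 / 2 * inner ℝ a x) ∂P := by
  let Z : Ω → ((Fin t → 𝒲) × EuclideanSpace ℝ (Fin d)) × (ℕ → Ξ) :=
    fun ω => (((fun i : Fin t => W i ω), θ ω), fun n => ξ n ω)
  have hZ : Measurable[MeasurableSpace.comap Z inferInstance] Z := comap_measurable Z
  have hZm : Measurable Z :=
    ((measurable_pi_lambda (fun ω (i : Fin t) => W i ω) fun i => h.measurable_noise i).prodMk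
      h.measurable_param).prodMk
      (measurable_pi_iff.2 h.measurable_algNoise)
  have hθ : Measurable[MeasurableSpace.comap Z inferInstance] θ := (measurable_snd.comp measurable_fst).comp hZ
  have hW : ∀ i < t, Measurable[MeasurableSpace.comap Z inferInstance] (W i) := fun i hi =>
    ((measurable_pi_apply (⟨i, hi⟩ : Fin t)).comp (measurable_fst.comp measurable_fst)).comp hZ
  have hξ : ∀ i, Measurable[MeasurableSpace.comap Z inferInstance] (ξ i) := fun i => ((measurable_pi_apply i).comp measurable_snd).comp hZ
  have hH : Measurable[MeasurableSpace.comap Z inferInstance] (history B π θ W ξ t) :=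
    measurable_history hlin hθ h.param_mem t hW fun i _ => hξ i
  have hA := measurable_action hH (hξ t)
  let Y : Ω → ℝ := fun ω =>
    φ ω * ((if action B π θ W ξ t ω = a then 1 else 0) * (if θ ω = x then 1 else 0))
  have hY : BddMeas (MeasurableSpace.comap Z inferInstance) Y := (hφ.mono hH.comap_le).mul
    ((BddMeas.ite (hA (measurableSet_singleton a))).mul
      (BddMeas.ite (hθ (measurableSet_singleton x))))
  have hg := B.measurable_g a ha x hx
  have hind : IndepFun Y (fun ω => B.g a x (W t ω)) P :=
    (IndepFun.of_measurable_comap (h.indepFun_noise_past t) hY.1).symm.comp measurable_id hg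
  have hmean : ∫ ω, B.g a x (W t ω) ∂P = 1 / 2 * inner ℝ a x := by
    rw [← hlin.meanReward_eq a ha x hx, Bandit.meanReward, ← h.map_noise t,
      integral_map (h.measurable_noise t).aemeasurable hg.aestronglyMeasurable]
  calc _ = ∫ ω, Y ω * B.g a x (W t ω) ∂P := by
        congr 1; funext ω
        simp only [Y, reward]
        split_ifs with h1 h2 <;> simp_all
    _ = (∫ ω, Y ω ∂P) * ∫ ω, B.g a x (W t ω) ∂P :=
        hind.integral_fun_mul_eq_mul_integral
          (hY.1.mono hZm.comap_le le_rfl).aestronglyMeasurable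
          (hg.comp (h.measurable_noise t)).aestronglyMeasurable
    _ = _ := by rw [hmean, ← integral_mul_const]

/-- The conditional probability of playing `a` in period `t` given the history. -/
def actProb (π : Policy B Ξ) (P : Measure Ω) (ξ : ℕ → Ω → Ξ) (t : ℕ)
    (a : EuclideanSpace ℝ (Fin d)) (h : Fin t → EuclideanSpace ℝ (Fin d) × ℝ) : ℝ :=
  ((P.map (ξ t)) {x | π.act t h x = a}).toReal

theorem IsModel.bddMeas_actProb (h : IsModel B P θ W ξ) (t : ℕ) (a : EuclideanSpace ℝ (Fin d)) :
    BddMeas (pastInfo B π θ W ξ t) fun ω => actProb π P ξ t a (history B π θ W ξ t ω) := by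
  have : IsProbabilityMeasure (P.map (ξ t)) :=
    Measure.isProbabilityMeasure_map (h.measurable_algNoise t).aemeasurable
  refine ⟨Measurable.comp (g := actProb π P ξ t a) ?_ (measurable_history_pastInfo t), 1,
    fun ω => ?_⟩
  · exact (measurable_measure_prodMk_left
      (π.measurable_act t (measurableSet_singleton a))).ennreal_toReal
  · exact (abs_of_nonneg ENNReal.toReal_nonneg).le.trans measureReal_le_one

-- `ξ t` is independent of the history and the parameter, so Fubini integrates it out with these
-- frozen. Letting `u` depend on `θ` as well is what yields conditional independence of action and
-- parameter.
open Classical in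
theorem IsModel.integral_action (h : IsModel B P θ W ξ) (hlin : B.IsLinear) (t : ℕ) {u : Ω → ℝ}
    (hu : BddMeas (pastInfo B π θ W ξ t ⊔ MeasurableSpace.comap θ inferInstance) u)
    (a : EuclideanSpace ℝ (Fin d)) :
    ∫ ω, u ω * (if action B π θ W ξ t ω = a then 1 else 0) ∂P =
    ∫ ω, u ω * actProb π P ξ t a (history B π θ W ξ t ω) ∂P := by
  let Z : Ω → (Fin t → Ξ) × (EuclideanSpace ℝ (Fin d) × (ℕ → 𝒲)) :=
    fun ω => ((fun i : Fin t => ξ i ω), (θ ω, fun n => W n ω))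
  have hZ : Measurable[MeasurableSpace.comap Z inferInstance] Z := comap_measurable Z
  have hZm : Measurable Z :=
    (measurable_pi_lambda (fun ω (i : Fin t) => ξ i ω) fun i => h.measurable_algNoise i).prodMk
      (h.measurable_param.prodMk (measurable_pi_iff.2 h.measurable_noise))
  have hθ : Measurable[MeasurableSpace.comap Z inferInstance] θ := (measurable_fst.comp measurable_snd).comp hZ
  have hW : ∀ i, Measurable[MeasurableSpace.comap Z inferInstance] (W i) := fun i =>
    ((measurable_pi_apply i).comp (measurable_snd.comp measurable_snd)).comp hZ
  have hξ : ∀ i < t, Measurable[MeasurableSpace.comap Z inferInstance] (ξ i) := fun i hi =>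
    ((measurable_pi_apply (⟨i, hi⟩ : Fin t)).comp measurable_fst).comp hZ
  have hH : Measurable[MeasurableSpace.comap Z inferInstance] (history B π θ W ξ t) :=
    measurable_history hlin hθ h.param_mem t (fun i _ => hW i) hξ
  have hu' : BddMeas (MeasurableSpace.comap Z inferInstance) u := hu.mono (sup_le hH.comap_le hθ.comap_le)
  -- The value of `u` is carried along with the history because `u` need not be a function of the
  -- history.
  let X : Ω → (Fin t → EuclideanSpace ℝ (Fin d) × ℝ) × ℝ := fun ω => (history B π θ W ξ t ω, u ω)
  have hX : Measurable[MeasurableSpace.comap Z inferInstance] X := hH.prodMk hu'.1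
  have hXm : Measurable X := hX.mono hZm.comap_le le_rfl
  have hind : IndepFun X (ξ t) P :=
    (IndepFun.of_measurable_comap (h.indepFun_algNoise_past t) hX).symm
  have hξt := h.measurable_algNoise t
  have : IsProbabilityMeasure (P.map (ξ t)) := Measure.isProbabilityMeasure_map hξt.aemeasurable
  have : IsProbabilityMeasure (P.map X) := Measure.isProbabilityMeasure_map hXm.aemeasurable
  have hmap := (indepFun_iff_map_prod_eq_prod_map_map hXm.aemeasurable hξt.aemeasurable).1 hind
  let F : ((Fin t → EuclideanSpace ℝ (Fin d) × ℝ) × ℝ) × Ξ → ℝ := fun z =>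
    z.1.2 * if π.act t z.1.1 z.2 = a then 1 else 0
  have hF : Measurable F := by
    refine (measurable_snd.comp measurable_fst).mul (Measurable.ite ?_ measurable_const
      measurable_const)
    exact ((π.measurable_act t).comp ((measurable_fst.comp measurable_fst).prodMk measurable_snd))
      (measurableSet_singleton a)
  have hFint : Integrable F ((P.map X).prod (P.map (ξ t))) := by
    rw [← hmap, integrable_map_measure hF.aestronglyMeasurable (hXm.prodMk hξt).aemeasurable]
    exact ((hu'.mono hZm.comap_le).mul (BddMeas.ite ((measurable_action
      (hH.mono hZm.comap_le le_rfl) hξt) (measurableSet_singleton a)))).integrable le_rfl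
  have hinner : ∀ z : (Fin t → EuclideanSpace ℝ (Fin d) × ℝ) × ℝ,
      ∫ e, F (z, e) ∂(P.map (ξ t)) = z.2 * actProb π P ξ t a z.1 := by
    intro z
    have hset : MeasurableSet {e | π.act t z.1 e = a} :=
      ((π.measurable_act t).comp measurable_prodMk_left) (measurableSet_singleton a)
    simp only [F]
    rw [integral_const_mul]
    congr 1
    rw [actProb, ← measureReal_def, ← integral_indicator_one hset]
    congr 1
    funext e
    simp [Set.indicator_apply]
  calc ∫ ω, u ω * (if action B π θ W ξ t ω = a then 1 else 0) ∂P
      = ∫ z, F z ∂(P.map fun ω => (X ω, ξ t ω)) := by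
        rw [integral_map (hXm.prodMk hξt).aemeasurable hF.aestronglyMeasurable]
        rfl
    _ = ∫ z, z.2 * actProb π P ξ t a z.1 ∂(P.map X) := by
        rw [hmap, integral_prod F hFint]
        simp_rw [hinner]
    _ = _ := by
        rw [integral_map hXm.aemeasurable]
        simp_rw [← hinner]
        exact hF.stronglyMeasurable.integral_prod_right.aestronglyMeasurable

open Classical in
theorem IsThompsonSampling.integral_action_eq {α : EuclideanSpace ℝ (Fin d) → EuclideanSpace ℝ (Fin d)}
    (hTS : IsThompsonSampling B α π P θ W ξ) (h : IsModel B P θ W ξ) (hlin : B.IsLinear) (t : ℕ)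
    {φ : Ω → ℝ} (hφ : BddMeas (pastInfo B π θ W ξ t) φ) {a : EuclideanSpace ℝ (Fin d)}
    (ha : a ∈ B.actions) :
    ∫ ω, φ ω * (if action B π θ W ξ t ω = a then 1 else 0) ∂P =
    ∫ ω, φ ω * ∑ y ∈ B.params with α y = a, (if θ ω = y then 1 else 0) ∂P := by
  have hle := h.pastInfo_le (π := π) hlin t
  have hA : Measurable (action B π θ W ξ t) :=
    measurable_action ((measurable_history_pastInfo t).mono hle le_rfl) (h.measurable_algNoise t)
  have hsum : ∀ ω, ∑ y ∈ B.params with α y = a, (if θ ω = y then (1 : ℝ) else 0) =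
      {ω | α (θ ω) = a}.indicator (fun _ => (1 : ℝ)) ω := by
    intro ω
    simp [Finset.sum_ite_eq, h.param_mem ω, Set.indicator_apply]
  have hact : ∀ ω, (if action B π θ W ξ t ω = a then (1 : ℝ) else 0) =
      {ω | action B π θ W ξ t ω = a}.indicator (fun _ => (1 : ℝ)) ω := by
    intro ω
    simp [Set.indicator_apply]
  have i1 : Integrable ({ω | action B π θ W ξ t ω = a}.indicator fun _ => (1 : ℝ)) P := by
    rw [← funext hact]
    exact (BddMeas.ite (hA (measurableSet_singleton a))).integrable le_rfl
  have i2 : Integrable ({ω | α (θ ω) = a}.indicator fun _ => (1 : ℝ)) P := by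
    rw [← funext hsum]
    exact (BddMeas.sum _ fun y _ =>
      BddMeas.ite (h.measurable_param (measurableSet_singleton y))).integrable le_rfl
  simp_rw [hsum, hact]
  rw [← integral_mul_condExp hle hφ i1, ← integral_mul_condExp hle hφ i2]
  refine integral_congr_ae ?_
  filter_upwards [hTS t a ha] with ω hω
  rw [hω]

open Classical in
/-- Thompson sampling samples from the posterior. -/
theorem IsThompsonSampling.exists_posteriorSampling
    {α : EuclideanSpace ℝ (Fin d) → EuclideanSpace ℝ (Fin d)}
    (hTS : IsThompsonSampling B α π P θ W ξ) (h : IsModel B P θ W ξ) (hlin : B.IsLinear)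
    (hA : (B.actions : Set (EuclideanSpace ℝ (Fin d))) ⊆ Metric.closedBall 0 1)
    (hΘ : (B.params : Set (EuclideanSpace ℝ (Fin d))) ⊆ Metric.closedBall 0 1)
    (hα : B.IsOptimalAction α) :
    ∃ p, PosteriorSampling P (pastInfo B π θ W ξ) B.actions B.params α θ (action B π θ W ξ)
      (reward B π θ W ξ) p := by
  have hle := h.pastInfo_le (π := π) hlin
  choose p hpm hp0 hp1 hp using fun t =>
    exists_posterior (P := P) (hle t) h.measurable_param h.param_mem
  have hbp : ∀ t, ∀ x ∈ B.params, BddMeas (pastInfo B π θ W ξ t) (p t x) := by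
    refine fun t x hx => ⟨hpm t x, 1, fun ω => ?_⟩
    rw [abs_of_nonneg (hp0 t x ω), ← hp1 t ω]
    exact Finset.single_le_sum (f := fun x => p t x ω) (fun y _ => hp0 t y ω) hx
  refine ⟨p, ⟨hle, pastInfo_mono, fun a ha => by simpa using hA ha, fun x hx => by simpa using hΘ hx,
    fun x hx => (hα x hx).1, h.measurable_param, h.param_mem,
    fun t => measurable_fst.comp (measurable_action_reward_pastInfo t),
    fun t ω => π.act_mem _ _ _, fun t => measurable_snd.comp (measurable_action_reward_pastInfo t),
    fun t ω => hlin.reward_mem _ (π.act_mem _ _ _) _ (h.param_mem ω) _, hpm, hp0, hp1,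
    fun t φ hφ a ha x hx => h.integral_reward hlin t hφ ha hx, fun t φ hφ a ha x hx => ?_⟩⟩
  let κ : Ω → ℝ := fun ω => actProb π P ξ t a (history B π θ W ξ t ω)
  have hκ : BddMeas (pastInfo B π θ W ξ t) κ := h.bddMeas_actProb t a
  have hθ : BddMeas (pastInfo B π θ W ξ t ⊔ MeasurableSpace.comap θ inferInstance)
      fun ω => if θ ω = x then 1 else 0 :=
    (BddMeas.ite (comap_measurable θ (measurableSet_singleton x))).mono le_sup_right
  have hφp := hφ.mul (hbp t x hx)
  -- Integrating out `ξ t` replaces the action by the history-measurable `κ`, after which `θ` can be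
  -- replaced by its posterior. Then `κ` is turned back into the action, so that the Thompson
  -- sampling identity applies to it alone.
  calc ∫ ω, φ ω * ((if action B π θ W ξ t ω = a then 1 else 0) * (if θ ω = x then 1 else 0)) ∂P
      = ∫ ω, (φ ω * if θ ω = x then 1 else 0) *
          (if action B π θ W ξ t ω = a then 1 else 0) ∂P := by
        congr 1; funext ω; ring
    _ = ∫ ω, (φ ω * if θ ω = x then 1 else 0) * κ ω ∂P :=
        h.integral_action hlin t ((hφ.mono le_sup_left).mul hθ) a
    _ = ∫ ω, (φ ω * κ ω) * (if θ ω = x then 1 else 0) ∂P := by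
        congr 1; funext ω; ring
    _ = ∫ ω, (φ ω * κ ω) * p t x ω ∂P := hp t _ (hφ.mul hκ) x hx
    _ = ∫ ω, (φ ω * p t x ω) * κ ω ∂P := by
        congr 1; funext ω; ring
    _ = ∫ ω, (φ ω * p t x ω) * (if action B π θ W ξ t ω = a then 1 else 0) ∂P :=
        (h.integral_action hlin t (hφp.mono le_sup_left) a).symm
    _ = ∫ ω, (φ ω * p t x ω) * ∑ y ∈ B.params with α y = a, (if θ ω = y then 1 else 0) ∂P :=
        hTS.integral_action_eq h hlin t hφp ha
    _ = ∫ ω, (φ ω * p t x ω) * ∑ y ∈ B.params with α y = a, p t y ω ∂P := by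
        simp_rw [Finset.mul_sum]
        rw [integral_finsetSum, integral_finsetSum]
        · exact Finset.sum_congr rfl fun y hy => hp t _ hφp y (Finset.mem_filter.1 hy).1
        · exact fun y hy => (hφp.mul (hbp t y (Finset.mem_filter.1 hy).1)).integrable (hle t)
        · exact fun y hy => ((hφp.mono (hle t)).mul
            (BddMeas.ite (h.measurable_param (measurableSet_singleton y)))).integrable le_rfl
    _ = ∫ ω, φ ω * (p t x ω * ∑ y ∈ B.params with α y = a, p t y ω) ∂P := by
        congr 1; funext ω; ring

end Model

/-! ### Tuning and conclusion -/

/-- Choice of the covering radius and of the trade-off parameter in the regret bound. -/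
theorem regret_bound_optimize {D T L : ℝ} (hD : 0 < D) (hT : 0 < T)
    (hL : L ≤ D * Real.log (1 + √(2 * T) / D)) :
    ∃ η : ℝ, 0 < η ∧
      T * (2 * D / √(2 * T) / 2) + (η * (D * (L / 2)) + T * η⁻¹) / 2 ≤
        D * √(T * Real.log (3 + 3 * √(2 * T) / D)) := by
  set w := √(2 * T) with hw
  have hw0 : 0 < w := Real.sqrt_pos.2 (by positivity)
  have hw2 : w ^ 2 = 2 * T := Real.sq_sqrt (by positivity)
  have hTw : T = w ^ 2 / 2 := by linarith
  set l := Real.log (1 + w / D) with hl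
  have hl0 : 0 < l := Real.log_pos (by have : 0 < w / D := by positivity
                                       linarith)
  set z := √l with hz
  have hz0 : 0 < z := Real.sqrt_pos.2 hl0
  have hz2 : z ^ 2 = l := Real.sq_sqrt hl0.le
  -- The constant `3` of the theorem is an upper bound for `e`, which absorbs the summand `1` coming
  -- from the discretization error.
  have hlog : 1 + l ≤ Real.log (3 + 3 * w / D) := by
    have h1 : 0 < 1 + w / D := by positivity
    have h2 : 1 + l = Real.log (Real.exp 1 * (1 + w / D)) := by
      rw [Real.log_mul (Real.exp_pos 1).ne' h1.ne', Real.log_exp]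
    rw [h2]
    refine Real.log_le_log (by positivity) ?_
    have h3 : 3 + 3 * w / D = 3 * (1 + w / D) := by ring
    rw [h3]
    exact mul_le_mul_of_nonneg_right Real.exp_one_lt_three.le h1.le
  -- This `η` equalizes `η D² z² / 2` and `T / η`. Each of the discretization and information terms
  -- then is a multiple of `D w / 2`, with factors `1` and `z`.
  refine ⟨w / (z * D), by positivity, ?_⟩
  have hlhs : T * (2 * D / w / 2) + (w / (z * D) * (D * (L / 2)) + T * (w / (z * D))⁻¹) / 2 ≤
      D * (w / 2 * (1 + z)) := by
    have h1 : w / (z * D) * (D * (L / 2)) ≤ w / (z * D) * (D * (D * z ^ 2 / 2)) := by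
      rw [hz2]
      gcongr
    have h2 : T * (2 * D / w / 2) + (w / (z * D) * (D * (D * z ^ 2 / 2)) +
        T * (w / (z * D))⁻¹) / 2 = D * (w / 2 * (1 + z)) := by
      rw [hTw]
      field_simp
      ring
    linarith
  refine hlhs.trans (mul_le_mul_of_nonneg_left ?_ hD.le)
  refine Real.le_sqrt_of_sq_le ?_
  -- This is `(1 + z)² ≤ 2 (1 + z²)`, which merges the two terms under one root.
  have h4 : (w / 2 * (1 + z)) ^ 2 ≤ T * (1 + l) := by
    rw [← hz2, hTw]
    nlinarith [mul_nonneg (sq_nonneg w) (sq_nonneg (1 - z))]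
  exact h4.trans (mul_le_mul_of_nonneg_left hlog hT.le)

end BayesBandit

end

theorem theorem2 {d : ℕ} (hd : 0 < d) {𝒲 Ξ Ω : Type*}
    [MeasurableSpace 𝒲] [MeasurableSpace Ξ] [MeasurableSpace Ω]
    (B : BayesBandit.Bandit d 𝒲) (hlin : B.IsLinear)
    (hA : (B.actions : Set (EuclideanSpace ℝ (Fin d))) ⊆ Metric.closedBall 0 1)
    (hΘ : (B.params : Set (EuclideanSpace ℝ (Fin d))) ⊆ Metric.closedBall 0 1)
    (α : EuclideanSpace ℝ (Fin d) → EuclideanSpace ℝ (Fin d)) (hα : B.IsOptimalAction α)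
    (P : Measure Ω) [IsProbabilityMeasure P]
    (θ : Ω → EuclideanSpace ℝ (Fin d)) (W : ℕ → Ω → 𝒲) (ξ : ℕ → Ω → Ξ)
    (hmodel : BayesBandit.IsModel B P θ W ξ)
    (π : BayesBandit.Policy B Ξ) (hTS : BayesBandit.IsThompsonSampling B α π P θ W ξ)
    (T : ℕ) :
    BayesBandit.bayesRegret B α π P θ W ξ T
      ≤ d * √(T * Real.log (3 + 3 * √(2 * T) / d)) := by
  classical
  -- The covering radius below divides by `√(2 * T)`, so `T = 0` is treated apart.
  rcases Nat.eq_zero_or_pos T with rfl | hT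
  · simp [BayesBandit.bayesRegret]
  have hD : (0 : ℝ) < d := Nat.cast_pos.2 hd
  have hT' : (0 : ℝ) < T := Nat.cast_pos.2 hT
  have hw : 0 < √(2 * (T : ℝ)) := Real.sqrt_pos.2 (by positivity)
  obtain ⟨p, hp⟩ := hTS.exists_posteriorSampling hmodel hlin hA hΘ hα
  -- With this radius `2 / r = √(2 * T) / d`, so the net size matches the logarithm in the bound.
  have hr : 0 < 2 * (d : ℝ) / √(2 * T) := by positivity
  obtain ⟨C, hCcard, hC⟩ := BayesBandit.exists_net hr B.params hp.norm_param_le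
  choose! c hcC hcr using hC
  have hL : Real.log C.card ≤ d * Real.log (1 + √(2 * (T : ℝ)) / d) := by
    obtain ⟨ω₀⟩ : Nonempty Ω := nonempty_of_isProbabilityMeasure P
    have hN : (0 : ℝ) < C.card :=
      Nat.cast_pos.2 (Finset.card_pos.2 ⟨_, hcC _ (hp.param_mem ω₀)⟩)
    rw [← Real.log_pow]
    refine Real.log_le_log hN (hCcard.trans (le_of_eq ?_))
    rw [finrank_euclideanSpace_fin]
    congr 2
    field_simp
  obtain ⟨η, hη, hbound⟩ := BayesBandit.regret_bound_optimize hD hT' hL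
  have hreg := hp.integral_regret_le hcC hr.le hη hcr T
  rw [finrank_euclideanSpace_fin] at hreg
  refine le_trans (le_of_eq ?_) (hreg.trans hbound)
  refine integral_congr_ae (Filter.Eventually.of_forall fun ω => ?_)
  have hθ := hmodel.param_mem ω
  simp only [hlin.meanReward_eq _ (hα _ hθ).1 _ hθ]
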